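/- Let $\alpha>0$, let $L:(0,\infty)\to(0,\infty)$ be a (measurable) slowly varying function, i.e. $\lim_{t\to\infty}L(at)/L(t)=1$ for every $a>0$, and let $\tau=\{\tau_i\}_{i\ge 0}$, defined on a probability space with probability $\mathbb P_\tau$ and expectation $\mathbb E_\tau$, be a persistent renewal process with $\tau_0=0$ and independent, identically distributed inter-arrival times of law $\mathbb P_\tau(\tau_1=n)=L(n)/n^{1+\alpha}$ for $n\ge 1$. Let $H\in(1/2,1)$ and let $\omega=\{\omega_n\}_{n\ge1}$, defined on another probability space with probability $\mathbb P_\omega$, be a centred, jointly Gaussian family with $\mathbb E_\omega[\omega_n\omega_m]=\gamma(n-m)$, where $\gamma:\mathbb Z\to\mathbb R$ satisfies, for some constant $C>0$, $\gamma(n)\le C(|n|^{2H-2}\wedge 1)$ for all $n\in\mathbb Z$ (with $|0|^{2H-2}\wedge1:=1$), and $\lim_{N\to\infty}N^{2-2H}\gamma(\lfloor Nt\rfloor)=|t|^{2H-2}$ for every real $t\ne0$. For $N\ge1$, $\beta>0$ and $h\in\mathbb R$ define the Wick ordered partition function, a random variable in $\omega$, by $$\tilde Z_{N,\beta}^{\omega,h}:=\mathbb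 E_\tau\Big[\exp\Big\{\sum_{n=1}^N(\beta\omega_n+h)\mathbf 1_{\{n\in\tau\}}-\tfrac12\mathrm{Var}_\omega\Big(\sum_{n=1}^N\beta\omega_n\mathbf 1_{\{n\in\tau\}}\Big)\Big\}\Big].$$ Fix $\hat\beta>0$ and $\hat h\in\mathbb R$, put $l(N):=\sum_{n=1}^N L(n)/n$, and let $$(\beta_N,h_N):=\begin{cases}\big(\hat\beta\,L(N)N^{-(\alpha+H-1)},\ \hat h\,L(N)N^{-\alpha}\big)&\text{if }0<\alpha<1,\\ \big(\hat\beta N^{-H},\ \hat hN^{-1}\big)&\text{if }\mathbb E_\tau[\tau_1]<\infty,\\ \big(\hat\beta\,l(N)N^{-H},\ \hat h\,l(N)N^{-1}\big)&\text{if }\alpha=1\text{ and }\mathbb E_\tau[\tau_1]=\infty.\end{cases}$$ Assume $\alpha+2H>2$. Then the family $\{\tilde Z_N:=\tilde Z_{N,\beta_N}^{\omega,h_N}\}_{N\ge1}$ of rescaled Wick ordered partition functions is uniformly integrable under $\mathbb P_\omega$. -/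

import Mathlib

open MeasureTheory ProbabilityTheory Filter Topology

noncomputable section

namespace CorrelatedPinning

/-- `L : (0, ∞) → (0, ∞)` is measurable and slowly varying at infinity. Only the values of `L` on
`(0, ∞)` are constrained. -/
structure IsSlowlyVarying (L : ℝ → ℝ) : Prop where
  pos : ∀ t : ℝ, 0 < t → 0 < L t
  measurable : Measurable (fun t : Set.Ioi (0 : ℝ) => L t)
  tendsto : ∀ a : ℝ, 0 < a → Tendsto (fun t : ℝ => L (a * t) / L t) atTop (𝓝 1)

/-- `τ` is a persistent renewal process on `ℕ` started from `τ 0 = 0`, whose independent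
inter-arrival times take the value `n ≥ 1` with probability `L n / n ^ (1 + α)`. Persistence
(finiteness of all the inter-arrival times) is expressed by the fact that `τ` is `ℕ`-valued; in
view of `strictMono` the natural-number subtractions do not truncate. -/
structure IsRenewalProcess {Ω : Type*} [MeasurableSpace Ω] (P : Measure Ω)
    (τ : ℕ → Ω → ℕ) (α : ℝ) (L : ℝ → ℝ) : Prop where
  measurable : ∀ i, Measurable (τ i)
  zero : ∀ x, τ 0 x = 0
  strictMono : ∀ x, StrictMono (fun i => τ i x)
  indep : iIndepFun (fun i x => τ (i + 1) x - τ i x) P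
  law : ∀ i n : ℕ, 1 ≤ n →
    P.real {x | τ (i + 1) x - τ i x = n} = L (n : ℝ) / (n : ℝ) ^ (1 + α)

/-- `ω = (ω_n)_{n ≥ 1}` is a centred, jointly Gaussian family with covariance
`E[ω_n ω_m] = γ (n - m)`, where `γ n ≲ |n| ^ (2 H - 2) ∧ 1` on `ℤ` and
`N ^ (2 - 2 H) γ ⌊N t⌋ → |t| ^ (2 H - 2)` for each real `t ≠ 0`. At `n = 0` one has
`|n| ^ (2 H - 2) ∧ 1 = ∞ ∧ 1 = 1`, hence the case distinction in `upper_bound`. -/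
structure IsCorrelatedGaussianEnvironment {Ω : Type*} [MeasurableSpace Ω] (P : Measure Ω)
    (ω : ℕ+ → Ω → ℝ) (γ : ℤ → ℝ) (H : ℝ) : Prop where
  gaussian : IsGaussianProcess ω P
  mean_zero : ∀ n : ℕ+, ∫ y, ω n y ∂P = 0
  covariance : ∀ n m : ℕ+, ∫ y, ω n y * ω m y ∂P = γ (((n : ℕ) : ℤ) - ((m : ℕ) : ℤ))
  upper_bound : ∃ C : ℝ, 0 < C ∧
    ∀ n : ℤ, γ n ≤ C * (if n = 0 then 1 else min (|(n : ℝ)| ^ (2 * H - 2)) 1)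
  scaling_limit : ∀ t : ℝ, t ≠ 0 →
    Tendsto (fun N : ℕ => (N : ℝ) ^ (2 - 2 * H) * γ ⌊(N : ℝ) * t⌋) atTop
      (𝓝 (|t| ^ (2 * H - 2)))

/-- The indicator of the event `n ∈ τ`, i.e. that `n` is one of the renewal times. -/
def contact {Ω : Type*} (τ : ℕ → Ω → ℕ) (n : ℕ) : Ω → ℝ :=
  Set.indicator {x | ∃ i, τ i x = n} 1

/-- The Wick ordered partition function, as a function of the environment,
`E_τ[exp{∑_{n=1}^N (β ω_n + h) 1_{n ∈ τ} - ½ Var_ω(∑_{n=1}^N β ω_n 1_{n ∈ τ})}]`. -/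
def wickPartition {Ωτ Ωω : Type*} [MeasurableSpace Ωτ] [MeasurableSpace Ωω]
    (Pτ : Measure Ωτ) (Pω : Measure Ωω) (τ : ℕ → Ωτ → ℕ) (ω : ℕ+ → Ωω → ℝ)
    (N : ℕ+) (β h : ℝ) (y : Ωω) : ℝ :=
  ∫ x, Real.exp ((∑ n ∈ Finset.Icc 1 N, (β * ω n y + h) * contact τ n x)
    - (1 / 2) * variance (fun y' => ∑ n ∈ Finset.Icc 1 N, β * ω n y' * contact τ n x) Pω) ∂Pτ

/-- `l(N) = ∑_{n=1}^N L(n) / n`, which for `α = 1` is the truncated mean of `τ_1`. -/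
def truncatedMean (L : ℝ → ℝ) (N : ℕ) : ℝ :=
  ∑ n ∈ Finset.Icc 1 N, L (n : ℝ) / (n : ℝ)

open Classical in
/-- The inverse temperature `β_N`. The three branches are `0 < α < 1`, then `E[τ_1] < ∞`, then
(the only case left for a renewal process as above) `α = 1` and `E[τ_1] = ∞`. -/
def betaScale {Ωτ : Type*} [MeasurableSpace Ωτ] (Pτ : Measure Ωτ) (τ : ℕ → Ωτ → ℕ)
    (α H : ℝ) (L : ℝ → ℝ) (βhat : ℝ) (N : ℕ+) : ℝ :=
  if α < 1 then βhat * (L ((N : ℕ) : ℝ) / ((N : ℕ) : ℝ) ^ (α + H - 1))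
  else if Integrable (fun x => (τ 1 x : ℝ)) Pτ then βhat * (1 / ((N : ℕ) : ℝ) ^ H)
  else βhat * (truncatedMean L N / ((N : ℕ) : ℝ) ^ H)

open Classical in
/-- The external field `h_N`, with the same three branches as `betaScale`. -/
def fieldScale {Ωτ : Type*} [MeasurableSpace Ωτ] (Pτ : Measure Ωτ) (τ : ℕ → Ωτ → ℕ)
    (α : ℝ) (L : ℝ → ℝ) (hhat : ℝ) (N : ℕ+) : ℝ :=
  if α < 1 then hhat * (L ((N : ℕ) : ℝ) / ((N : ℕ) : ℝ) ^ α)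
  else if Integrable (fun x => (τ 1 x : ℝ)) Pτ then hhat * (1 / ((N : ℕ) : ℝ))
  else hhat * (truncatedMean L N / ((N : ℕ) : ℝ))

/-- The rescaled Wick ordered partition function, i.e. with `β = β_N` and `h = h_N`. -/
def rescaledWickPartition {Ωτ Ωω : Type*} [MeasurableSpace Ωτ] [MeasurableSpace Ωω]
    (Pτ : Measure Ωτ) (Pω : Measure Ωω) (τ : ℕ → Ωτ → ℕ) (ω : ℕ+ → Ωω → ℝ)
    (α H : ℝ) (L : ℝ → ℝ) (βhat hhat : ℝ) (N : ℕ+) : Ωω → ℝ :=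
  wickPartition Pτ Pω τ ω N (betaScale Pτ τ α H L βhat N) (fieldScale Pτ τ α L hhat N)

end CorrelatedPinning

end

noncomputable section

namespace CorrelatedPinning

/-! Fix the renewal path. Let K be its number of contacts in [1, N], X = β ∑ ω_n 1_{n ∈ τ}, and V
the ω-variance of X. The partition function is the τ-average of exp(hK) exp(X - V/2), and the Wick
exponential exp(X - V/2) has ω-mean 1 and second moment exp(V). A second moment of the whole average
would involve exponentials of an interaction energy. Truncating V inside the τ-expectation needs
only the mean of V. Where V ≤ A, the Wick exponential is bounded in L², so it contributes little on
events of small probability. Where V > A, its mean 1 suffices: Young and Markov bound the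
contribution by η E_τ[exp(2|h|K)] + E_τ[V]/(ηA) (`setLIntegral_enorm_wickPartition_le`). It remains
to bound E_τ[V] and E_τ[exp(2|h_N|K)] uniformly in N.

Both bounds come from one scale s with β_N = βhat s(N) N^(1-H) and h_N = hhat s(N) in all three
regimes (`IsRenewalScale`). Since 1 - E[exp(-ξ/n)] ≥ c s(n) for a gap ξ, Chernoff's bound gives
O(1/s(n)) expected renewals in a window of length n. Independence of increments then bounds the
expected energy with kernel |n-m|^(2H-2) by C / (s(N)² N^(2-2H)), and the factor β_N² cancels this
(`exists_energy_le`). The power sum involved is controlled because s(n) n^δ is almost decreasing for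
some δ > 2 - 2H; this is where α + 2H > 2 enters. The same monotonicity yields the exponential
moments (`exists_integral_exp_le`). -/

/-! ### Slowly varying functions and Potter's bounds -/

/-- The points of `[0, 2]` at which a pointwise null sequence of measurable functions is not small
have eventually small measure. -/
lemma eventually_volume_exceed_lt {g : ℕ → ℝ → ℝ} (hg : ∀ n, Measurable (g n))
    (hlim : ∀ y, Tendsto (fun n => g n y) atTop (𝓝 0)) {ε : ℝ} (hε : 0 < ε) :
    ∀ᶠ n in atTop, volume ({y | ε ≤ |g n y|} ∩ Set.Icc 0 2) < ENNReal.ofReal (1 / 2) := by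
  have h : TendstoInMeasure (volume.restrict (Set.Icc (0 : ℝ) 2)) g atTop (fun _ => 0) :=
    tendstoInMeasure_of_tendsto_ae (fun n => (hg n).aestronglyMeasurable)
      (Eventually.of_forall hlim)
  rw [tendstoInMeasure_iff_dist] at h
  have h1 := (h ε hε).eventually (gt_mem_nhds (show 0 < ENNReal.ofReal (1 / 2) by simp))
  filter_upwards [h1] with n hn
  rw [Measure.restrict_apply] at hn
  · simpa [Real.dist_eq] using hn
  · simpa [Real.dist_eq] using measurableSet_le measurable_const (hg n).abs

/-- Uniform convergence theorem for slowly varying functions, in additive form. -/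
lemma uniform_additive_slow_variation {f : ℝ → ℝ} (hf : Measurable f)
    (hlim : ∀ u, Tendsto (fun x => f (x + u) - f x) atTop (𝓝 0)) {ε : ℝ} (hε : 0 < ε) :
    ∃ X : ℝ, ∀ x, X ≤ x → ∀ u ∈ Set.Icc (0 : ℝ) 1, |f (x + u) - f x| ≤ ε := by
  by_contra! hcon
  choose x hx u hu hbig using fun n : ℕ => hcon n
  have hxlim : Tendsto x atTop atTop := tendsto_atTop_mono hx tendsto_natCast_atTop_atTop
  have hxulim : Tendsto (fun n => x n + u n) atTop atTop :=
    tendsto_atTop_mono (fun n => by linarith [(hu n).1]) hxlim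
  -- Points near x n, and points near x n + u n, have exceptional sets of measure below 1/2. After a
  -- shift by u n they cannot cover [1, 2], so some y has f (x n + y) close to both values,
  -- contradicting the gap ε. For y in [1, 2] both y and y - u n stay in [0, 2].
  have h1 := eventually_volume_exceed_lt (g := fun n y => f (x n + y) - f (x n))
    (fun n => by fun_prop) (fun y => (hlim y).comp hxlim) (half_pos hε)
  have h2 := eventually_volume_exceed_lt (g := fun n y => f (x n + u n + y) - f (x n + u n))
    (fun n => by fun_prop) (fun y => (hlim y).comp hxulim) (half_pos hε)
  obtain ⟨n, hn1, hn2⟩ := (h1.and h2).exists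
  set B := {y | ε / 2 ≤ |f (x n + y) - f (x n)|} ∩ Set.Icc (0 : ℝ) 2
  set B' := {y | ε / 2 ≤ |f (x n + u n + y) - f (x n + u n)|} ∩ Set.Icc (0 : ℝ) 2
  have hshift : volume ((fun y => y + -u n) ⁻¹' B') = volume B' :=
    measure_preimage_add_right volume (-u n) B'
  have hlt : volume (B ∪ (fun y => y + -u n) ⁻¹' B') < volume (Set.Icc (1 : ℝ) 2) := by
    calc _ ≤ volume B + volume ((fun y => y + -u n) ⁻¹' B') := measure_union_le _ _
      _ < ENNReal.ofReal (1 / 2) + ENNReal.ofReal (1 / 2) := by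
        rw [hshift]; exact ENNReal.add_lt_add hn1 hn2
      _ = volume (Set.Icc (1 : ℝ) 2) := by
        rw [← ENNReal.ofReal_add (by norm_num) (by norm_num), Real.volume_Icc]; norm_num
  obtain ⟨y, hy, hyn⟩ : ∃ y ∈ Set.Icc (1 : ℝ) 2, y ∉ B ∪ (fun y => y + -u n) ⁻¹' B' := by
    by_contra! hsub
    exact absurd (measure_mono hsub) (not_le.2 hlt)
  have hy1 : |f (x n + y) - f (x n)| < ε / 2 := by
    by_contra! h
    exact hyn (Or.inl ⟨h, by linarith [hy.1], hy.2⟩)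
  have hy2 : |f (x n + y) - f (x n + u n)| < ε / 2 := by
    by_contra! h
    refine hyn (Or.inr ⟨?_, ?_, ?_⟩)
    · simpa [show x n + u n + (y + -u n) = x n + y by ring] using h
    · linarith [hy.1, (hu n).2]
    · linarith [hy.2, (hu n).1]
  have := hbig n
  rw [abs_lt] at hy1 hy2
  rcases lt_abs.1 this with h | h <;> linarith [hy1.1, hy1.2, hy2.1, hy2.2]

lemma IsSlowlyVarying.tendsto_log {L : ℝ → ℝ} (hL : IsSlowlyVarying L) (u : ℝ) :
    Tendsto (fun x => Real.log (L (Real.exp (x + u))) - Real.log (L (Real.exp x))) atTop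
      (𝓝 0) := by
  have h := ((hL.tendsto (Real.exp u) (Real.exp_pos u)).comp Real.tendsto_exp_atTop).log one_ne_zero
  rw [Real.log_one] at h
  refine h.congr fun x => ?_
  have h1 := hL.pos _ (Real.exp_pos x)
  have h2 := hL.pos _ (mul_pos (Real.exp_pos u) (Real.exp_pos x))
  rw [Function.comp, Real.log_div h2.ne' h1.ne', Real.exp_add, mul_comm (Real.exp x)]

/-- Potter's bound, in additive form. -/
lemma IsSlowlyVarying.exists_abs_log_sub_le {L : ℝ → ℝ} (hL : IsSlowlyVarying L) {ε : ℝ}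
    (hε : 0 < ε) :
    ∃ X : ℝ, ∀ x, X ≤ x → ∀ v, 0 ≤ v →
      |Real.log (L (Real.exp (x + v))) - Real.log (L (Real.exp x))| ≤ ε * (v + 1) := by
  have hmeas : Measurable (fun x => Real.log (L (Real.exp x))) :=
    Real.measurable_log.comp
      (hL.measurable.comp (Real.measurable_exp.subtype_mk (h := fun x => Real.exp_pos x)))
  obtain ⟨X, hX⟩ := uniform_additive_slow_variation hmeas hL.tendsto_log hε
  refine ⟨X, fun x hx => ?_⟩
  -- Chaining unit steps, each costing at most ε.
  have key : ∀ k : ℕ, ∀ v : ℝ, 0 ≤ v → v ≤ k →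
      |Real.log (L (Real.exp (x + v))) - Real.log (L (Real.exp x))| ≤ ε * k := by
    intro k
    induction k with
    | zero =>
      intro v hv hv'
      have : v = 0 := le_antisymm (by simpa using hv') hv
      simp [this]
    | succ k ih =>
      intro v hv hv'
      push_cast at hv' ⊢
      by_cases h : v ≤ 1
      · refine (hX x hx v ⟨hv, h⟩).trans ?_
        nlinarith [Nat.cast_nonneg (α := ℝ) k]
      · have h1 := ih (v - 1) (by linarith) (by linarith)
        have h2 := hX (x + (v - 1)) (by linarith) 1 ⟨zero_le_one, le_rfl⟩
        rw [show x + (v - 1) + 1 = x + v by ring] at h2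
        calc _ ≤ _ := abs_sub_le _ (Real.log (L (Real.exp (x + (v - 1))))) _
          _ ≤ ε + ε * k := add_le_add h2 h1
          _ = _ := by ring
  intro v hv
  refine (key ⌈v⌉₊ v hv (Nat.le_ceil v)).trans ?_
  exact mul_le_mul_of_nonneg_left (Nat.ceil_lt_add_one hv).le hε.le

lemma IsSlowlyVarying.pos_natCast {L : ℝ → ℝ} (hL : IsSlowlyVarying L) {n : ℕ} (hn : 1 ≤ n) :
    0 < L n := hL.pos _ (by exact_mod_cast hn)

/-- Potter's bounds along the integers. -/
lemma IsSlowlyVarying.potter {L : ℝ → ℝ} (hL : IsSlowlyVarying L) {ε : ℝ} (hε : 0 < ε) :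
    ∃ C : ℝ, 1 ≤ C ∧ ∀ n m : ℕ, 1 ≤ n → n ≤ m →
      L m ≤ C * ((m : ℝ) / n) ^ ε * L n ∧ L n ≤ C * ((m : ℝ) / n) ^ ε * L m := by
  obtain ⟨X, hX⟩ := hL.exists_abs_log_sub_le hε
  -- Beyond T the additive bound applies. Below T a maximum K of finitely many ratios suffices, and
  -- a pair straddling T is compared through T.
  set T : ℕ := max 1 ⌈Real.exp X⌉₊ with hT
  have hT1 : 1 ≤ T := le_max_left _ _
  have hlarge : ∀ n m : ℕ, T ≤ n → n ≤ m →
      L m ≤ Real.exp ε * ((m : ℝ) / n) ^ ε * L n ∧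
        L n ≤ Real.exp ε * ((m : ℝ) / n) ^ ε * L m := by
    intro n m hn hnm
    have hn0 : (0 : ℝ) < n := by exact_mod_cast hT1.trans hn
    have hm0 : (0 : ℝ) < m := by exact_mod_cast (hT1.trans hn).trans hnm
    have hLn := hL.pos _ hn0
    have hLm := hL.pos _ hm0
    have hr : (1 : ℝ) ≤ (m : ℝ) / n := by
      rw [one_le_div hn0]; exact_mod_cast hnm
    have hx : X ≤ Real.log n := by
      rw [Real.le_log_iff_exp_le hn0]
      exact (Nat.le_ceil _).trans (by exact_mod_cast (le_max_right _ _).trans hn)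
    have h := hX _ hx (Real.log ((m : ℝ) / n)) (Real.log_nonneg hr)
    rw [Real.log_div hm0.ne' hn0.ne', add_sub_cancel, Real.exp_log hm0, Real.exp_log hn0,
      ← Real.log_div hm0.ne' hn0.ne'] at h
    have hexp : Real.exp (ε * (Real.log ((m : ℝ) / n) + 1))
        = Real.exp ε * ((m : ℝ) / n) ^ ε := by
      rw [Real.rpow_def_of_pos (by positivity), ← Real.exp_add]; ring_nf
    rw [abs_le] at h
    rw [← hexp]
    constructor
    · rw [← Real.log_le_log_iff hLm (by positivity), Real.log_mul (Real.exp_pos _).ne' hLn.ne',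
        Real.log_exp]
      linarith
    · rw [← Real.log_le_log_iff hLn (by positivity), Real.log_mul (Real.exp_pos _).ne' hLm.ne',
        Real.log_exp]
      linarith
  obtain ⟨K, hK1, hK⟩ : ∃ K : ℝ, 1 ≤ K ∧ ∀ n m : ℕ, 1 ≤ n → n ≤ T → 1 ≤ m → m ≤ T →
      L n ≤ K * L m := by
    obtain ⟨K, hK⟩ := ((Finset.Icc 1 T ×ˢ Finset.Icc 1 T).image
      (fun p : ℕ × ℕ => L p.1 / L p.2)).bddAbove
    refine ⟨max 1 K, le_max_left _ _, fun n m hn hnT hm hmT => ?_⟩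
    have hLm := hL.pos_natCast hm
    have : L n / L m ≤ K := hK (Finset.mem_coe.2 (Finset.mem_image.2
      ⟨(n, m), by simp [hn, hnT, hm, hmT], rfl⟩))
    rw [← div_le_iff₀ hLm]
    exact this.trans (le_max_right _ _)
  have hE : 1 ≤ Real.exp ε := Real.one_le_exp hε.le
  refine ⟨K * Real.exp ε, one_le_mul_of_one_le_of_one_le hK1 hE, fun n m hn hnm => ?_⟩
  have hn0 : (0 : ℝ) < n := by exact_mod_cast hn
  have hm0 : (0 : ℝ) < m := by exact_mod_cast hn.trans hnm
  have hT0 : (0 : ℝ) < T := by exact_mod_cast hT1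
  have hLn := hL.pos _ hn0
  have hLm := hL.pos _ hm0
  have hLT := hL.pos _ hT0
  have hr : (1 : ℝ) ≤ ((m : ℝ) / n) ^ ε :=
    Real.one_le_rpow ((one_le_div hn0).2 (by exact_mod_cast hnm)) hε.le
  rcases le_total T n with h1 | h1
  · have h := hlarge n m h1 hnm
    have hc : Real.exp ε * ((m : ℝ) / n) ^ ε ≤ K * Real.exp ε * ((m : ℝ) / n) ^ ε := by
      rw [mul_assoc K]; exact le_mul_of_one_le_left (by positivity) hK1
    exact ⟨h.1.trans (mul_le_mul_of_nonneg_right hc hLn.le),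
      h.2.trans (mul_le_mul_of_nonneg_right hc hLm.le)⟩
  rcases le_total m T with h2 | h2
  · have hc : K ≤ K * Real.exp ε * ((m : ℝ) / n) ^ ε := by
      rw [mul_assoc]
      exact le_mul_of_one_le_right (by positivity) (one_le_mul_of_one_le_of_one_le hE hr)
    exact ⟨(hK m n (hn.trans hnm) h2 hn h1).trans (mul_le_mul_of_nonneg_right hc hLn.le),
      (hK n m hn h1 (hn.trans hnm) h2).trans (mul_le_mul_of_nonneg_right hc hLm.le)⟩
  · have h := hlarge T m le_rfl h2
    have hmono : ((m : ℝ) / T) ^ ε ≤ ((m : ℝ) / n) ^ ε := by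
      gcongr
    have hTn := hK T n hT1 le_rfl hn h1
    have hnT := hK n T hn h1 hT1 le_rfl
    constructor
    · calc L m ≤ Real.exp ε * ((m : ℝ) / T) ^ ε * L T := h.1
        _ ≤ Real.exp ε * ((m : ℝ) / n) ^ ε * (K * L n) := by gcongr
        _ = _ := by ring
    · calc L n ≤ K * L T := hnT
        _ ≤ K * (Real.exp ε * ((m : ℝ) / T) ^ ε * L m) := by gcongr; exact h.2
        _ ≤ K * (Real.exp ε * ((m : ℝ) / n) ^ ε * L m) := by gcongr
        _ = _ := by ring

/-! ### The truncated mean -/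

lemma IsSlowlyVarying.truncatedMean_pos {L : ℝ → ℝ} (hL : IsSlowlyVarying L) {n : ℕ}
    (hn : 1 ≤ n) : 0 < truncatedMean L n := by
  refine Finset.sum_pos (fun k hk => ?_) ⟨1, by simp [hn]⟩
  have hk1 := (Finset.mem_Icc.1 hk).1
  exact div_pos (hL.pos_natCast hk1) (by exact_mod_cast hk1)

/-- The terms with k ≥ n/2 alone suffice: there are at least n/2 of them, and by Potter with
exponent 1 each is at least L n / (2 C n). -/
lemma IsSlowlyVarying.le_truncatedMean {L : ℝ → ℝ} (hL : IsSlowlyVarying L) :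
    ∃ C : ℝ, 0 < C ∧ ∀ n : ℕ, 1 ≤ n → L n ≤ C * truncatedMean L n := by
  obtain ⟨C, hC1, hC⟩ := hL.potter one_pos
  have hC0 : 0 < C := by linarith
  refine ⟨C * 2 * 2, by positivity, fun n hn => ?_⟩
  have hn0 : (0 : ℝ) < n := by exact_mod_cast hn
  have hLn := hL.pos _ hn0
  have h1 : ∑ k ∈ Finset.Icc ((n + 1) / 2) n, L n / (C * 2 * n) ≤ truncatedMean L n := by
    calc _ ≤ ∑ k ∈ Finset.Icc ((n + 1) / 2) n, L k / k := by
          refine Finset.sum_le_sum fun k hk => ?_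
          obtain ⟨hk1, hk2⟩ := Finset.mem_Icc.1 hk
          have hk3 : 1 ≤ k := by omega
          have hk0 : (0 : ℝ) < k := by exact_mod_cast hk3
          have h2k : (n : ℝ) ≤ 2 * k := by exact_mod_cast (by omega : n ≤ 2 * k)
          have hkn : (k : ℝ) ≤ n := by exact_mod_cast hk2
          have h := (hC k n hk3 hk2).1
          rw [Real.rpow_one] at h
          have hLk := hL.pos _ hk0
          rw [div_le_div_iff₀ (by positivity) hk0]
          rw [mul_div_assoc', div_mul_eq_mul_div, le_div_iff₀ hk0] at h
          nlinarith [mul_pos (mul_pos hLk hC0) hn0]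
      _ ≤ _ := by
          refine Finset.sum_le_sum_of_subset_of_nonneg (fun k hk => ?_) fun k hk _ => ?_
          · rw [Finset.mem_Icc] at hk ⊢; omega
          · have := hL.pos_natCast (Finset.mem_Icc.1 hk).1
            positivity
  rw [Finset.sum_const, Nat.card_Icc, nsmul_eq_mul] at h1
  have h2 : (n : ℝ) / 2 ≤ ((n + 1 - (n + 1) / 2 : ℕ) : ℝ) := by
    rw [div_le_iff₀ two_pos]
    exact_mod_cast (by omega : n ≤ (n + 1 - (n + 1) / 2) * 2)
  have h3 : (n : ℝ) / 2 * (L n / (C * 2 * n)) ≤ truncatedMean L n :=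
    (mul_le_mul_of_nonneg_right h2 (by positivity)).trans h1
  have h4 : L n = C * 2 * 2 * ((n : ℝ) / 2 * (L n / (C * 2 * n))) := by field_simp
  rw [h4]
  exact mul_le_mul_of_nonneg_left h3 (by positivity)

lemma sum_Ioc_one_div_le_log {n m : ℕ} (hn : 1 ≤ n) (hnm : n ≤ m) :
    ∑ k ∈ Finset.Ioc n m, 1 / (k : ℝ) ≤ Real.log ((m : ℝ) / n) := by
  have hn0 : (0 : ℝ) < n := by exact_mod_cast hn
  induction m, hnm using Nat.le_induction with
  | base => simp
  | succ m hnm ih =>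
    have hm0 : (0 : ℝ) < m := by exact_mod_cast hn.trans hnm
    rw [Finset.sum_Ioc_succ_top (by omega)]
    have h := Real.one_sub_inv_le_log_of_pos (x := ((m + 1 : ℕ) : ℝ) / m) (by positivity)
    have h2 : 1 - (((m + 1 : ℕ) : ℝ) / m)⁻¹ = 1 / ((m + 1 : ℕ) : ℝ) := by
      push_cast; field_simp; ring
    have h3 : Real.log (((m + 1 : ℕ) : ℝ) / n)
        = Real.log ((m : ℝ) / n) + Real.log (((m + 1 : ℕ) : ℝ) / m) := by
      rw [← Real.log_mul (by positivity) (by positivity)]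
      congr 1
      field_simp
    rw [h3]
    linarith

/-- Upper Potter bound for the truncated mean. -/
lemma IsSlowlyVarying.truncatedMean_potter {L : ℝ → ℝ} (hL : IsSlowlyVarying L) {ε : ℝ}
    (hε : 0 < ε) :
    ∃ C : ℝ, 0 < C ∧ ∀ n m : ℕ, 1 ≤ n → n ≤ m →
      truncatedMean L m ≤ C * ((m : ℝ) / n) ^ ε * truncatedMean L n := by
  -- Half of the exponent pays for L k / L n, the other half for the logarithm from the harmonic
  -- sum.
  obtain ⟨C, hC1, hC⟩ := hL.potter (half_pos hε)
  obtain ⟨D, hD0, hD⟩ := hL.le_truncatedMean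
  have hC0 : 0 < C := by linarith
  refine ⟨1 + C * D / (ε / 2), by positivity, fun n m hn hnm => ?_⟩
  have hn0 : (0 : ℝ) < n := by exact_mod_cast hn
  have hm0 : (0 : ℝ) < m := by exact_mod_cast hn.trans hnm
  have hr : (1 : ℝ) ≤ (m : ℝ) / n := (one_le_div hn0).2 (by exact_mod_cast hnm)
  have hLn := hL.pos _ hn0
  have hl := hL.truncatedMean_pos hn
  have hsplit : truncatedMean L m
      = truncatedMean L n + ∑ k ∈ Finset.Ioc n m, L k / k := by
    have hu : Finset.Icc 1 m = Finset.Icc 1 n ∪ Finset.Ioc n m := by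
      ext k; simp only [Finset.mem_union, Finset.mem_Icc, Finset.mem_Ioc]; omega
    rw [truncatedMean, hu, Finset.sum_union]
    · rfl
    · rw [Finset.disjoint_left]
      intro k; simp only [Finset.mem_Icc, Finset.mem_Ioc]; omega
  have hsum : ∑ k ∈ Finset.Ioc n m, L k / (k : ℝ)
      ≤ C * ((m : ℝ) / n) ^ (ε / 2) * L n * ∑ k ∈ Finset.Ioc n m, 1 / (k : ℝ) := by
    rw [Finset.mul_sum]
    refine Finset.sum_le_sum fun k hk => ?_
    obtain ⟨hk1, hk2⟩ := Finset.mem_Ioc.1 hk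
    have h := (hC n k hn hk1.le).1
    have hkm : (k : ℝ) ≤ m := by exact_mod_cast hk2
    rw [mul_one_div]
    gcongr
    refine h.trans ?_
    gcongr
  have hlog : Real.log ((m : ℝ) / n) ≤ ((m : ℝ) / n) ^ (ε / 2) / (ε / 2) :=
    Real.log_le_rpow_div (by positivity) (half_pos hε)
  have hpow : ((m : ℝ) / n) ^ ε = ((m : ℝ) / n) ^ (ε / 2) * ((m : ℝ) / n) ^ (ε / 2) := by
    rw [← Real.rpow_add (by positivity), add_halves]
  calc truncatedMean L m
      ≤ truncatedMean L n + C * ((m : ℝ) / n) ^ (ε / 2) * (D * truncatedMean L n)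
          * (((m : ℝ) / n) ^ (ε / 2) / (ε / 2)) := by
        rw [hsplit]
        gcongr
        refine hsum.trans ?_
        gcongr
        · exact hD n hn
        · exact (sum_Ioc_one_div_le_log hn hnm).trans hlog
    _ = truncatedMean L n * 1 + C * D / (ε / 2) * ((m : ℝ) / n) ^ ε * truncatedMean L n := by
        rw [hpow]; ring
    _ ≤ truncatedMean L n * ((m : ℝ) / n) ^ ε
          + C * D / (ε / 2) * ((m : ℝ) / n) ^ ε * truncatedMean L n := by
        gcongr
        exact Real.one_le_rpow hr hε.le
    _ = _ := by ring

/-! ### Laplace transform of the gaps and renewal scales -/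

/-- Follows from exp(-t) ≤ 1/(1 + t). It makes the Laplace gap of ξ at 1/n at least half of
E[min(ξ/n, 1)], which can be read off the atoms. -/
lemma exp_neg_le_one_sub_half_min {t : ℝ} (ht : 0 ≤ t) :
    Real.exp (-t) ≤ 1 - 1 / 2 * min t 1 := by
  have h1 : Real.exp (-t) * (1 + t) ≤ 1 := by
    have := Real.add_one_le_exp t
    calc Real.exp (-t) * (1 + t) ≤ Real.exp (-t) * Real.exp t := by gcongr; linarith
      _ = 1 := by rw [← Real.exp_add]; simp
  have h0 := Real.exp_pos (-t)
  rcases le_total t 1 with h | h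
  · rw [min_eq_left h]
    nlinarith
  · rw [min_eq_right h]
    nlinarith

section Renewal

variable {Ω : Type*} [MeasurableSpace Ω] {P : Measure Ω} {τ : ℕ → Ω → ℕ} {α : ℝ} {L : ℝ → ℝ}

/-- The Laplace transform of an inter-arrival time is bounded through finitely many of its
atoms. -/
lemma IsRenewalProcess.mgf_gap_le_sum [IsProbabilityMeasure P] (hτ : IsRenewalProcess P τ α L)
    (i : ℕ) {n : ℕ} (hn : 1 ≤ n) (F : Finset ℕ) (hF : ∀ k ∈ F, 1 ≤ k) :
    mgf (fun x => ((τ (i + 1) x - τ i x : ℕ) : ℝ)) P (-(1 / n))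
      ≤ 1 - ∑ k ∈ F, 1 / 2 * min ((k : ℝ) / n) 1 * (L k / (k : ℝ) ^ (1 + α)) := by
  have hn0 : (0 : ℝ) < n := by exact_mod_cast hn
  have hm : Measurable fun x => τ (i + 1) x - τ i x :=
    (hτ.measurable _).sub (hτ.measurable _)
  have hms : ∀ k, MeasurableSet {x | τ (i + 1) x - τ i x = k} := fun k =>
    hm (measurableSet_singleton k)
  have hint : ∀ k ∈ F, Integrable (fun x => 1 / 2 * min ((k : ℝ) / n) 1 *
      Set.indicator {x | τ (i + 1) x - τ i x = k} 1 x) P := fun k _ =>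
    ((integrable_const (1 : ℝ)).indicator (hms k)).const_mul _
  have hbound : ∀ x, Real.exp (-(1 / n) * ((τ (i + 1) x - τ i x : ℕ) : ℝ))
      ≤ 1 - ∑ k ∈ F, 1 / 2 * min ((k : ℝ) / n) 1 *
        Set.indicator {x | τ (i + 1) x - τ i x = k} (1 : Ω → ℝ) x := by
    intro x
    have h := exp_neg_le_one_sub_half_min
      (t := ((τ (i + 1) x - τ i x : ℕ) : ℝ) / n) (by positivity)
    rw [show -(1 / n) * ((τ (i + 1) x - τ i x : ℕ) : ℝ)
      = -(((τ (i + 1) x - τ i x : ℕ) : ℝ) / n) by ring]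
    refine h.trans (sub_le_sub_left ?_ _)
    -- At most one atom of F is hit; if none is, the sum vanishes and the bound is trivial.
    rw [Finset.sum_congr rfl (g := fun k => if τ (i + 1) x - τ i x = k then
      1 / 2 * min ((k : ℝ) / n) 1 else 0) (fun k _ => by
        simp only [Set.indicator_apply, Set.mem_ofPred_eq, Pi.one_apply]; split_ifs <;> simp)]
    rw [Finset.sum_ite_eq]
    split_ifs
    · exact le_rfl
    · positivity
  calc _ ≤ ∫ x, (1 - ∑ k ∈ F, 1 / 2 * min ((k : ℝ) / n) 1 *
        Set.indicator {x | τ (i + 1) x - τ i x = k} (1 : Ω → ℝ) x) ∂P := by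
        refine integral_mono_of_nonneg (Eventually.of_forall fun x => (Real.exp_pos _).le)
          ((integrable_const _).sub (integrable_finsetSum _ hint)) (Eventually.of_forall hbound)
    _ = _ := by
        rw [integral_sub (integrable_const _) (integrable_finsetSum _ hint),
          integral_finsetSum _ hint]
        simp only [integral_const, probReal_univ, smul_eq_mul, mul_one]
        congr 1
        refine Finset.sum_congr rfl fun k hk => ?_
        rw [integral_const_mul, integral_indicator_one (hms k), hτ.law i k (hF k hk)]

/-- Uses only that gaps are at least 1; this is the scale 1/n of the finite-mean regime. -/
lemma IsRenewalProcess.mgf_gap_le_one_sub [IsProbabilityMeasure P]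
    (hτ : IsRenewalProcess P τ α L) (i : ℕ) {n : ℕ} (hn : 1 ≤ n) :
    mgf (fun x => ((τ (i + 1) x - τ i x : ℕ) : ℝ)) P (-(1 / n)) ≤ 1 - 1 / 2 * (1 / n) := by
  have hn0 : (1 : ℝ) ≤ n := by exact_mod_cast hn
  have h := exp_neg_le_one_sub_half_min (t := 1 / (n : ℝ)) (by positivity)
  rw [min_eq_left ((div_le_one (by linarith)).2 hn0)] at h
  refine le_trans ?_ h
  calc _ ≤ ∫ _, Real.exp (-(1 / (n : ℝ))) ∂P := by
        refine integral_mono_of_nonneg (Eventually.of_forall fun x => (Real.exp_pos _).le)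
          (integrable_const _) (Eventually.of_forall fun x => ?_)
        have h1 : 1 ≤ τ (i + 1) x - τ i x := by
          have : τ i x < τ (i + 1) x := hτ.strictMono x (Nat.lt_succ_self i)
          omega
        have h2 : (1 : ℝ) ≤ ((τ (i + 1) x - τ i x : ℕ) : ℝ) := by exact_mod_cast h1
        refine Real.exp_le_exp.2 ?_
        rw [neg_mul, neg_le_neg_iff]
        exact le_mul_of_one_le_right (by positivity) h2
    _ = _ := by simp

/-- For `α > 1` the inter-arrival times have finite mean. -/
lemma IsRenewalProcess.integrable_of_one_lt [IsProbabilityMeasure P]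
    (hL : IsSlowlyVarying L) (hτ : IsRenewalProcess P τ α L) (hα : 1 < α) :
    Integrable (fun x => (τ 1 x : ℝ)) P := by
  obtain ⟨C, hC1, hC⟩ := hL.potter (ε := (α - 1) / 2) (by linarith)
  have hm := hτ.measurable 1
  -- Potter from 1 with exponent (α - 1)/2 bounds the terms L k / k^α by a multiple of k^(-(1 + (α -
  -- 1)/2)).
  have hsum : Summable fun k : ℕ => (k : ℝ) * P.real (τ 1 ⁻¹' {k}) := by
    have h1 : Summable fun k : ℕ => C * L (1 : ℕ) * (1 / (k : ℝ) ^ (1 + (α - 1) / 2)) :=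
      (Real.summable_one_div_nat_rpow.2 (by linarith)).mul_left _
    refine h1.of_nonneg_of_le (fun k => by positivity) fun k => ?_
    rcases Nat.eq_zero_or_pos k with rfl | hk
    · have := hL.pos_natCast le_rfl
      simp only [CharP.cast_eq_zero, zero_mul]
      positivity
    have hk0 : (0 : ℝ) < k := by exact_mod_cast hk
    have hlaw : P.real (τ 1 ⁻¹' {k}) = L k / (k : ℝ) ^ (1 + α) := by
      rw [← hτ.law 0 k hk]
      congr 1
      ext x
      simp [hτ.zero x]
    have h2 := (hC 1 k le_rfl hk).1
    rw [Nat.cast_one, div_one] at h2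
    have h3 : (k : ℝ) ^ (1 + α) = k ^ ((α - 1) / 2) * k ^ (1 + (α - 1) / 2) * k := by
      rw [← Real.rpow_add hk0, ← Real.rpow_add_one hk0.ne']; congr 1; ring
    rw [hlaw, h3, Nat.cast_one]
    calc (k : ℝ) * (L k / (k ^ ((α - 1) / 2) * k ^ (1 + (α - 1) / 2) * k))
        = L k * (1 / (k ^ ((α - 1) / 2) * k ^ (1 + (α - 1) / 2))) := by field_simp
      _ ≤ C * k ^ ((α - 1) / 2) * L 1 * (1 / (k ^ ((α - 1) / 2) * k ^ (1 + (α - 1) / 2))) := by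
        gcongr
      _ = _ := by field_simp
  refine ⟨(measurable_from_nat.comp hm).aestronglyMeasurable, ?_⟩
  rw [hasFiniteIntegral_iff_ofReal (Eventually.of_forall fun x => by positivity)]
  have : ∫⁻ x, ENNReal.ofReal (τ 1 x : ℝ) ∂P
      = ∫⁻ k, ENNReal.ofReal (k : ℝ) ∂(P.map (τ 1)) :=
    (lintegral_map (f := fun k : ℕ => ENNReal.ofReal (k : ℝ)) measurable_from_nat hm).symm
  rw [this, lintegral_countable']
  have h4 : ∀ k : ℕ, ENNReal.ofReal (k : ℝ) * P.map (τ 1) {k}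
      = ENNReal.ofReal ((k : ℝ) * P.real (τ 1 ⁻¹' {k})) := fun k => by
    rw [Measure.map_apply hm (measurableSet_singleton k), ENNReal.ofReal_mul (by positivity),
      ofReal_measureReal]
  simp_rw [h4]
  exact hsum.tsum_ofReal_lt_top

/-- `s` is a scale for the renewal process: it is positive, `s n * n ^ δ` is almost decreasing, and
`1 - E[exp (-ξ / n)]` dominates `s n`. -/
structure IsRenewalScale (P : Measure Ω) (τ : ℕ → Ω → ℕ) (s : ℕ → ℝ) (δ : ℝ) : Prop where
  pos : ∀ n, 1 ≤ n → 0 < s n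
  almost_anti : ∃ C : ℝ, 0 < C ∧ ∀ n m : ℕ, 1 ≤ n → n ≤ m →
    s m * (m : ℝ) ^ δ ≤ C * (s n * (n : ℝ) ^ δ)
  mgf_gap_le : ∃ c : ℝ, 0 < c ∧ ∀ i n : ℕ, 1 ≤ n →
    mgf (fun x => ((τ (i + 1) x - τ i x : ℕ) : ℝ)) P (-(1 / n)) ≤ 1 - c * s n

lemma almost_anti_of_potter {f : ℕ → ℝ} {C ε : ℝ} (a : ℝ)
    (hf : ∀ n m : ℕ, 1 ≤ n → n ≤ m → f m ≤ C * ((m : ℝ) / n) ^ ε * f n)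
    (n m : ℕ) (hn : 1 ≤ n) (hnm : n ≤ m) :
    f m / (m : ℝ) ^ a * (m : ℝ) ^ (a - ε) ≤ C * (f n / (n : ℝ) ^ a * (n : ℝ) ^ (a - ε)) := by
  have hn0 : (0 : ℝ) < n := by exact_mod_cast hn
  have hm0 : (0 : ℝ) < m := by exact_mod_cast hn.trans hnm
  have h := hf n m hn hnm
  rw [Real.div_rpow hm0.le hn0.le] at h
  rw [Real.rpow_sub hn0, Real.rpow_sub hm0]
  have h1 : f m / (m : ℝ) ^ a * ((m : ℝ) ^ a / (m : ℝ) ^ ε) = f m / (m : ℝ) ^ ε := by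
    field_simp
  have h2 : C * (f n / (n : ℝ) ^ a * ((n : ℝ) ^ a / (n : ℝ) ^ ε)) = C * (f n / (n : ℝ) ^ ε) := by
    field_simp
  rw [h1, h2, div_le_iff₀ (by positivity)]
  refine h.trans (le_of_eq ?_)
  field_simp

/-- The gaps in [n, 2n] suffice for the Laplace bound: these n + 1 atoms each have mass at least of
order L n / n^(1 + α), and there the truncation min(k/n, 1) equals 1. -/
lemma IsRenewalProcess.isRenewalScale_of_lt_one [IsProbabilityMeasure P]
    (hL : IsSlowlyVarying L) (hτ : IsRenewalProcess P τ α L) (hα : 0 < α) {δ : ℝ} (hδ : δ < α) :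
    IsRenewalScale P τ (fun n => L n / (n : ℝ) ^ α) δ where
  pos n hn := by
    have := hL.pos_natCast hn
    have : (0 : ℝ) < n := by exact_mod_cast hn
    positivity
  almost_anti := by
    obtain ⟨C, hC1, hC⟩ := hL.potter (sub_pos.2 hδ)
    have h := almost_anti_of_potter (f := fun n => L n) α fun n m hn hnm => (hC n m hn hnm).1
    rw [sub_sub_cancel] at h
    exact ⟨C, by linarith, h⟩
  mgf_gap_le := by
    obtain ⟨C, hC1, hC⟩ := hL.potter one_pos
    have hC0 : 0 < C := by linarith
    refine ⟨1 / (4 * C * 2 ^ (1 + α)), by positivity, fun i n hn => ?_⟩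
    have hn0 : (0 : ℝ) < n := by exact_mod_cast hn
    have hLn := hL.pos _ hn0
    refine (hτ.mgf_gap_le_sum i hn (Finset.Icc n (2 * n)) fun k hk =>
      hn.trans (Finset.mem_Icc.1 hk).1).trans (sub_le_sub_left ?_ _)
    calc 1 / (4 * C * 2 ^ (1 + α)) * (L n / (n : ℝ) ^ α)
        = n * (1 / 2 * (L n / (2 * C) / (2 * n) ^ (1 + α))) := by
          rw [Real.mul_rpow two_pos.le hn0.le, Real.rpow_add hn0, Real.rpow_one]
          field_simp
          ring
      _ ≤ ((n + 1 : ℕ) : ℝ) * (1 / 2 * (L n / (2 * C) / (2 * n) ^ (1 + α))) := by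
          gcongr; simp
      _ = ∑ _k ∈ Finset.Icc n (2 * n), 1 / 2 * (L n / (2 * C) / (2 * n) ^ (1 + α)) := by
          rw [Finset.sum_const, Nat.card_Icc, nsmul_eq_mul]
          congr 3
          omega
      _ ≤ _ := by
          refine Finset.sum_le_sum fun k hk => ?_
          obtain ⟨hk1, hk2⟩ := Finset.mem_Icc.1 hk
          have hk0 : (0 : ℝ) < k := by exact_mod_cast hn.trans hk1
          have hLk := hL.pos _ hk0
          have hk3 : (k : ℝ) ≤ 2 * n := by exact_mod_cast hk2
          have hk4 : (n : ℝ) ≤ k := by exact_mod_cast hk1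
          rw [min_eq_right ((one_le_div hn0).2 hk4), mul_one]
          have h := (hC n k hn hk1).2
          rw [Real.rpow_one] at h
          have h2 : (k : ℝ) / n ≤ 2 := by rwa [div_le_iff₀ hn0]
          have h3 : L n / (2 * C) ≤ L k := by
            rw [div_le_iff₀ (by positivity)]
            calc L n ≤ C * (k / n) * L k := h
              _ ≤ C * 2 * L k := by gcongr
              _ = _ := by ring
          gcongr

lemma IsRenewalProcess.isRenewalScale_one_div [IsProbabilityMeasure P]
    (hτ : IsRenewalProcess P τ α L) :
    IsRenewalScale P τ (fun n => 1 / (n : ℝ)) 1 where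
  pos n hn := by
    have : (0 : ℝ) < n := by exact_mod_cast hn
    positivity
  almost_anti := by
    refine ⟨1, one_pos, fun n m hn hnm => ?_⟩
    have hn0 : (0 : ℝ) < n := by exact_mod_cast hn
    have hm0 : (0 : ℝ) < m := by exact_mod_cast hn.trans hnm
    rw [Real.rpow_one, Real.rpow_one, one_div_mul_cancel hn0.ne', one_div_mul_cancel hm0.ne',
      one_mul]
  mgf_gap_le := ⟨1 / 2, by norm_num, fun i _ hn => hτ.mgf_gap_le_one_sub i hn⟩

/-- For α = 1 the atoms k ≤ n contribute (k/n) L k / k², which sum to l(n)/n exactly. -/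
lemma IsRenewalProcess.isRenewalScale_truncatedMean [IsProbabilityMeasure P]
    (hL : IsSlowlyVarying L) (hτ : IsRenewalProcess P τ 1 L) {δ : ℝ} (hδ : δ < 1) :
    IsRenewalScale P τ (fun n => truncatedMean L n / (n : ℝ)) δ where
  pos n hn := by
    have := hL.truncatedMean_pos hn
    have : (0 : ℝ) < n := by exact_mod_cast hn
    positivity
  almost_anti := by
    obtain ⟨C, hC0, hC⟩ := hL.truncatedMean_potter (sub_pos.2 hδ)
    have h := almost_anti_of_potter (f := truncatedMean L) 1 hC
    simp only [sub_sub_cancel, Real.rpow_one] at h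
    exact ⟨C, hC0, h⟩
  mgf_gap_le := by
    refine ⟨1 / 2, by norm_num, fun i n hn => ?_⟩
    have hn0 : (0 : ℝ) < n := by exact_mod_cast hn
    refine (hτ.mgf_gap_le_sum i hn (Finset.Icc 1 n) fun k hk =>
      (Finset.mem_Icc.1 hk).1).trans (sub_le_sub_left (le_of_eq ?_) _)
    rw [truncatedMean, Finset.sum_div, Finset.mul_sum]
    refine Finset.sum_congr rfl fun k hk => ?_
    obtain ⟨hk1, hk2⟩ := Finset.mem_Icc.1 hk
    have hk0 : (0 : ℝ) < k := by exact_mod_cast hk1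
    rw [min_eq_left ((div_le_one hn0).2 (by exact_mod_cast hk2)), Real.rpow_add hk0, Real.rpow_one]
    field_simp

/-- The couplings are governed by a single scale of the renewal process. -/
lemma IsRenewalProcess.exists_isRenewalScale [IsProbabilityMeasure P] (hα : 0 < α)
    (hL : IsSlowlyVarying L) (hτ : IsRenewalProcess P τ α L) {H : ℝ}
    (hH : H ∈ Set.Ioo (1 / 2 : ℝ) 1) (hαH : 2 < α + 2 * H) (βhat hhat : ℝ) :
    ∃ (s : ℕ → ℝ) (δ : ℝ), 2 - 2 * H < δ ∧ IsRenewalScale P τ s δ ∧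
      ∀ N : ℕ+, betaScale P τ α H L βhat N = βhat * (s N * ((N : ℕ) : ℝ) ^ (1 - H)) ∧
        fieldScale P τ α L hhat N = hhat * s N := by
  obtain ⟨hH1, hH2⟩ := hH
  by_cases h1 : α < 1
  -- The midpoint of 2 - 2H and α: the interval is nonempty because α + 2H > 2, and staying below α
  -- leaves room for the slowly varying factor.
  · refine ⟨_, (α + (2 - 2 * H)) / 2, by linarith,
      hτ.isRenewalScale_of_lt_one hL hα (by linarith), fun N => ?_⟩
    have hN : (0 : ℝ) < ((N : ℕ) : ℝ) := by exact_mod_cast N.pos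
    refine ⟨?_, by rw [fieldScale, if_pos h1]⟩
    rw [betaScale, if_pos h1, show α + H - 1 = α - (1 - H) by ring, Real.rpow_sub hN]
    field_simp
  by_cases h2 : Integrable (fun x => (τ 1 x : ℝ)) P
  · refine ⟨_, 1, by linarith, hτ.isRenewalScale_one_div, fun N => ?_⟩
    have hN : (0 : ℝ) < ((N : ℕ) : ℝ) := by exact_mod_cast N.pos
    refine ⟨?_, by rw [fieldScale, if_neg h1, if_pos h2]⟩
    rw [betaScale, if_neg h1, if_pos h2, Real.rpow_sub hN, Real.rpow_one]
    field_simp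
  · have hα1 : α = 1 := by
      refine le_antisymm ?_ (not_lt.1 h1)
      by_contra! h
      exact h2 (hτ.integrable_of_one_lt hL h)
    refine ⟨_, (1 + (2 - 2 * H)) / 2, by linarith,
      IsRenewalProcess.isRenewalScale_truncatedMean hL (hα1 ▸ hτ) (by linarith), fun N => ?_⟩
    have hN : (0 : ℝ) < ((N : ℕ) : ℝ) := by exact_mod_cast N.pos
    refine ⟨?_, by rw [fieldScale, if_neg h1, if_neg h2]⟩
    rw [betaScale, if_neg h1, if_neg h2, Real.rpow_sub hN, Real.rpow_one]
    field_simp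

end Renewal

/-! ### Dyadic summation and renewal counts -/

/-- Weighted sums of a sequence whose partial sums grow at most like `n ^ δ`, against `k ^ (-θ)`
with `θ < δ`. -/
lemma exists_sum_rpow_neg_mul_le {θ δ : ℝ} (hθ : 0 < θ) (hθδ : θ < δ) :
    ∃ K : ℝ, 0 < K ∧ ∀ (u : ℕ → ℝ) (B : ℝ) (N : ℕ), (∀ k, 0 ≤ u k) → 0 ≤ B →
      (∀ n, 1 ≤ n → n ≤ N → ∑ k ∈ Finset.Icc 1 n, u k ≤ B * (n : ℝ) ^ δ) →
      ∀ n ≤ N, ∑ k ∈ Finset.Icc 1 n, (k : ℝ) ^ (-θ) * u k ≤ K * B * (n : ℝ) ^ (δ - θ) := by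
  have hq : (2 : ℝ) ^ (-(δ - θ)) < 1 :=
    Real.rpow_lt_one_of_one_lt_of_neg one_lt_two (by linarith)
  -- K is the fixed point of the halving recursion K ↦ K 2^(-(δ - θ)) + 2^θ: the first term comes
  -- from [1, n/2], the second from (n/2, n], where the weight is at most (n/2)^(-θ).
  set K : ℝ := 2 ^ θ / (1 - 2 ^ (-(δ - θ))) with hK
  have hK0 : 0 < K := div_pos (by positivity) (by linarith)
  have hKeq : K * 2 ^ (-(δ - θ)) + 2 ^ θ = K := by
    have : 1 - (2 : ℝ) ^ (-(δ - θ)) ≠ 0 := by linarith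
    rw [hK]; field_simp; ring
  refine ⟨K, hK0, fun u B N hu hB hU n => ?_⟩
  induction n using Nat.strong_induction_on with
  | _ n ih =>
    intro hnN
    rcases Nat.eq_zero_or_pos n with rfl | hn
    · rw [Finset.Icc_eq_empty (by norm_num), Finset.sum_empty]; positivity
    have hn0 : (0 : ℝ) < n := by exact_mod_cast hn
    have h1 := ih (n / 2) (Nat.div_lt_self hn one_lt_two) ((Nat.div_le_self _ _).trans hnN)
    have hunion : Finset.Icc 1 n = Finset.Icc 1 (n / 2) ∪ Finset.Ioc (n / 2) n := by
      ext k; simp only [Finset.mem_union, Finset.mem_Icc, Finset.mem_Ioc]; omega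
    have hdisj : Disjoint (Finset.Icc 1 (n / 2)) (Finset.Ioc (n / 2) n) := by
      rw [Finset.disjoint_left]; intro k
      simp only [Finset.mem_Icc, Finset.mem_Ioc]; omega
    have h2 : ∑ k ∈ Finset.Ioc (n / 2) n, (k : ℝ) ^ (-θ) * u k
        ≤ ((n : ℝ) / 2) ^ (-θ) * (B * (n : ℝ) ^ δ) := by
      calc _ ≤ ∑ k ∈ Finset.Ioc (n / 2) n, ((n : ℝ) / 2) ^ (-θ) * u k := by
            refine Finset.sum_le_sum fun k hk => ?_
            refine mul_le_mul_of_nonneg_right ?_ (hu k)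
            refine Real.rpow_le_rpow_of_nonpos (by positivity) ?_ (by linarith)
            rw [div_le_iff₀ two_pos]
            have := (Finset.mem_Ioc.1 hk).1
            exact_mod_cast (by omega : n ≤ k * 2)
        _ = ((n : ℝ) / 2) ^ (-θ) * ∑ k ∈ Finset.Ioc (n / 2) n, u k := by rw [Finset.mul_sum]
        _ ≤ _ := by
            gcongr
            refine le_trans ?_ (hU n hn hnN)
            rw [hunion, Finset.sum_union hdisj]
            exact le_add_of_nonneg_left (Finset.sum_nonneg fun k _ => hu k)
    have h3 : (((n / 2 : ℕ) : ℝ)) ^ (δ - θ) ≤ ((n : ℝ) / 2) ^ (δ - θ) :=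
      Real.rpow_le_rpow (by positivity) Nat.cast_div_le (by linarith)
    rw [hunion, Finset.sum_union hdisj]
    calc _ ≤ K * B * ((n : ℝ) / 2) ^ (δ - θ) + ((n : ℝ) / 2) ^ (-θ) * (B * (n : ℝ) ^ δ) :=
          add_le_add (h1.trans (by gcongr)) h2
      _ = (K * 2 ^ (-(δ - θ)) + 2 ^ θ) * B * (n : ℝ) ^ (δ - θ) := by
          rw [Real.div_rpow hn0.le two_pos.le, Real.div_rpow hn0.le two_pos.le,
            Real.rpow_neg two_pos.le, Real.rpow_neg two_pos.le, Real.rpow_neg hn0.le,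
            Real.rpow_sub hn0]
          field_simp
      _ = _ := by rw [hKeq]

section Renewal

variable {Ω : Type*} [MeasurableSpace Ω] {P : Measure Ω} {τ : ℕ → Ω → ℕ} {α : ℝ} {L : ℝ → ℝ}

lemma IsRenewalProcess.sub_eq_sum (hτ : IsRenewalProcess P τ α L) (i l : ℕ) (x : Ω) :
    τ (i + l) x - τ i x = ∑ j ∈ Finset.Ico i (i + l), (τ (j + 1) x - τ j x) := by
  induction l with
  | zero => simp
  | succ l ih =>
    rw [← add_assoc, Finset.sum_Ico_succ_top (by omega), ← ih]
    have h1 : τ i x ≤ τ (i + l) x := (hτ.strictMono x).monotone (by omega)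
    have h2 : τ (i + l) x ≤ τ (i + l + 1) x := (hτ.strictMono x).monotone (by omega)
    omega

lemma IsRenewalProcess.le_sub (hτ : IsRenewalProcess P τ α L) (i l : ℕ) (x : Ω) :
    l ≤ τ (i + l) x - τ i x := by
  induction l with
  | zero => simp
  | succ l ih =>
    have h1 : τ i x ≤ τ (i + l) x := (hτ.strictMono x).monotone (by omega)
    have h2 : τ (i + l) x < τ (i + (l + 1)) x := hτ.strictMono x (by omega)
    omega

lemma IsRenewalProcess.measurable_sub (hτ : IsRenewalProcess P τ α L) (i l : ℕ) :
    Measurable fun x => τ (i + l) x - τ i x :=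
  (hτ.measurable _).sub (hτ.measurable _)

/-- The two variables are sums of disjoint blocks of gaps. -/
lemma IsRenewalProcess.indepFun_sub (hτ : IsRenewalProcess P τ α L) (i l : ℕ) :
    IndepFun (τ i) (fun x => τ (i + l) x - τ i x) P := by
  have h := hτ.indep.indepFun_finset (Finset.Ico 0 i) (Finset.Ico i (i + l))
    (Finset.Ico_disjoint_Ico_consecutive 0 i (i + l)) fun j => hτ.measurable_sub j 1
  have h2 := h.comp (φ := fun f : Finset.Ico 0 i → ℕ => ∑ j, f j)
    (ψ := fun f : Finset.Ico i (i + l) → ℕ => ∑ j, f j) (by fun_prop) (by fun_prop)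
  convert h2 using 1
  · ext x
    have := hτ.sub_eq_sum 0 i x
    rw [zero_add, hτ.zero x, Nat.sub_zero] at this
    rw [this, Function.comp, ← Finset.sum_coe_sort]
  · ext x
    rw [hτ.sub_eq_sum i l x, Function.comp, ← Finset.sum_coe_sort]

lemma IsRenewalProcess.mgf_sub (hτ : IsRenewalProcess P τ α L) (i l : ℕ) (t : ℝ) :
    mgf (fun x => ((τ (i + l) x - τ i x : ℕ) : ℝ)) P t
      = ∏ j ∈ Finset.Ico i (i + l), mgf (fun x => ((τ (j + 1) x - τ j x : ℕ) : ℝ)) P t := by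
  have h := hτ.indep.comp (fun _ (n : ℕ) => (n : ℝ)) fun _ => measurable_from_nat
  have h2 := h.mgf_sum (t := t) (fun j => measurable_from_nat.comp (hτ.measurable_sub j 1))
    (Finset.Ico i (i + l))
  have h3 : (fun x => ((τ (i + l) x - τ i x : ℕ) : ℝ))
      = ∑ j ∈ Finset.Ico i (i + l), ((fun n : ℕ => (n : ℝ)) ∘ fun x => τ (j + 1) x - τ j x) := by
    ext x
    rw [hτ.sub_eq_sum i l x, Finset.sum_apply]
    push_cast
    rfl
  rw [h3, h2]
  rfl

/-- Chernoff's bound for the increments of the renewal process. -/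
lemma IsRenewalProcess.measureReal_sub_le [IsProbabilityMeasure P]
    (hτ : IsRenewalProcess P τ α L) {n : ℕ} {r : ℝ}
    (hr : ∀ i, mgf (fun x => ((τ (i + 1) x - τ i x : ℕ) : ℝ)) P (-(1 / n)) ≤ r) (i l m : ℕ) :
    P.real {x | τ (i + l) x - τ i x ≤ m} ≤ Real.exp (m / n) * r ^ l := by
  have hmeas : Measurable fun x => ((τ (i + l) x - τ i x : ℕ) : ℝ) :=
    measurable_from_nat.comp (hτ.measurable_sub i l)
  have hle : -(1 / (n : ℝ)) ≤ 0 := by rw [neg_nonpos]; positivity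
  have hint : Integrable (fun x => Real.exp (-(1 / (n : ℝ)) * ((τ (i + l) x - τ i x : ℕ) : ℝ)))
      P := by
    refine Integrable.of_bound (hmeas.const_mul _).exp.aestronglyMeasurable 1
      (Eventually.of_forall fun x => ?_)
    rw [Real.norm_of_nonneg (Real.exp_pos _).le, Real.exp_le_one_iff]
    exact mul_nonpos_of_nonpos_of_nonneg hle (by positivity)
  have h := measure_le_le_exp_mul_mgf (μ := P) (m : ℝ) hle hint
  rw [hτ.mgf_sub, neg_neg, one_div_mul_eq_div] at h
  have hset : {x | τ (i + l) x - τ i x ≤ m}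
      = {x | ((τ (i + l) x - τ i x : ℕ) : ℝ) ≤ (m : ℝ)} := by
    ext x; simp only [Set.mem_ofPred_eq, Nat.cast_le]
  rw [hset]
  refine h.trans ?_
  gcongr
  refine (Finset.prod_le_prod (fun j _ => mgf_nonneg) fun j _ => hr j).trans (by simp)

/-- A bound on the expected number of renewals within distance n after the i-th one: Chernoff at
parameter 1/n gives e (1 - c s n)^l, a geometric series. -/
lemma IsRenewalScale.exists_sum_measureReal_le [IsProbabilityMeasure P]
    (hτ : IsRenewalProcess P τ α L) {s : ℕ → ℝ} {δ : ℝ} (hs : IsRenewalScale P τ s δ) :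
    ∃ C : ℝ, 0 < C ∧ ∀ i n K : ℕ, 1 ≤ n →
      ∑ l ∈ Finset.range K, P.real {x | τ (i + l) x - τ i x ≤ n} ≤ C / s n := by
  obtain ⟨c, hc0, hc⟩ := hs.mgf_gap_le
  refine ⟨Real.exp 1 / c, by positivity, fun i n K hn => ?_⟩
  have hn0 : (0 : ℝ) < n := by exact_mod_cast hn
  have hsn := hs.pos n hn
  have hr0 : 0 ≤ 1 - c * s n := mgf_nonneg.trans (hc 0 n hn)
  calc _ ≤ ∑ l ∈ Finset.range K, Real.exp 1 * (1 - c * s n) ^ l := by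
        refine Finset.sum_le_sum fun l _ => ?_
        have := hτ.measureReal_sub_le (fun i => hc i n hn) i l n
        rwa [div_self hn0.ne'] at this
    _ = Real.exp 1 * ∑ l ∈ Finset.range K, (1 - c * s n) ^ l := by rw [Finset.mul_sum]
    _ ≤ Real.exp 1 * (1 / (c * s n)) := by
        gcongr
        rw [le_div_iff₀ (by positivity)]
        have := geom_sum_mul_neg (1 - c * s n) K
        rw [sub_sub_cancel] at this
        rw [this]
        linarith [pow_nonneg hr0 K]
    _ = _ := by field_simp

/-- The expected interaction of a renewal time with the following ones. -/
lemma IsRenewalScale.exists_interaction_le [IsProbabilityMeasure P]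
    (hτ : IsRenewalProcess P τ α L) {s : ℕ → ℝ} {δ θ : ℝ} (hs : IsRenewalScale P τ s δ)
    (hθ : 0 < θ) (hθδ : θ < δ) :
    ∃ C : ℝ, 0 < C ∧ ∀ i N M : ℕ, 1 ≤ N →
      ∑ k ∈ Finset.range (N + 1), (if k = 0 then 1 else (k : ℝ) ^ (-θ)) *
        ∑ l ∈ Finset.range M, P.real {x | τ (i + l) x - τ i x = k}
      ≤ C / (s N * (N : ℝ) ^ θ) := by
  obtain ⟨C, hC0, hC⟩ := hs.exists_sum_measureReal_le hτ
  obtain ⟨D, hD0, hD⟩ := hs.almost_anti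
  obtain ⟨K, hK0, hK⟩ := exists_sum_rpow_neg_mul_le hθ hθδ
  refine ⟨(K + 1) * (C * D), by positivity, fun i N M hN => ?_⟩
  have hN0 : (1 : ℝ) ≤ N := by exact_mod_cast hN
  have hsN := hs.pos N hN
  set u : ℕ → ℝ := fun k => ∑ l ∈ Finset.range M, P.real {x | τ (i + l) x - τ i x = k} with hu
  have hu0 : ∀ k, 0 ≤ u k := fun k => Finset.sum_nonneg fun l _ => measureReal_nonneg
  -- Almost monotonicity of s n * n ^ δ turns the count bound C / s n into B n^δ for every n ≤ N,
  -- with B depending only on the endpoint N.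
  set B : ℝ := C * D / (s N * (N : ℝ) ^ δ) with hB
  have hU : ∀ n, 1 ≤ n → n ≤ N → ∑ k ∈ Finset.range (n + 1), u k ≤ B * (n : ℝ) ^ δ := by
    intro n hn hnN
    have hn0 : (0 : ℝ) < n := by exact_mod_cast hn
    have hsn := hs.pos n hn
    rw [hu, Finset.sum_comm]
    calc _ = ∑ l ∈ Finset.range M, P.real {x | τ (i + l) x - τ i x ≤ n} := by
          refine Finset.sum_congr rfl fun l _ => ?_
          have hset : {x | τ (i + l) x - τ i x ≤ n}
              = (fun x => τ (i + l) x - τ i x) ⁻¹' ((Finset.range (n + 1) : Finset ℕ) : Set ℕ) := by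
            ext x; simp
          rw [hset]
          exact sum_measureReal_preimage_singleton _
            (fun k _ => hτ.measurable_sub i l (measurableSet_singleton k))
      _ ≤ C / s n := hC i n M hn
      _ ≤ B * (n : ℝ) ^ δ := by
          rw [hB, div_mul_eq_mul_div, div_le_div_iff₀ hsn (by positivity)]
          nlinarith [hD n N hn hnN]
  have h0 : u 0 ≤ B := by
    have h := hU 1 le_rfl hN
    rw [Nat.cast_one, Real.one_rpow, mul_one] at h
    refine le_trans ?_ h
    exact Finset.single_le_sum (f := u) (fun k _ => hu0 k) (by simp)
  have h1 := hK u B N hu0 (by positivity) (fun n hn hnN => by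
    refine le_trans ?_ (hU n hn hnN)
    refine Finset.sum_le_sum_of_subset_of_nonneg (fun k hk => ?_) fun k _ _ => hu0 k
    rw [Finset.mem_Icc] at hk; rw [Finset.mem_range]; omega) N le_rfl
  have hsplit : Finset.range (N + 1) = insert 0 (Finset.Icc 1 N) := by
    ext k; simp only [Finset.mem_range, Finset.mem_insert, Finset.mem_Icc]; omega
  rw [hsplit, Finset.sum_insert (by simp), if_pos rfl, one_mul]
  have h2 : ∑ k ∈ Finset.Icc 1 N, (if k = 0 then 1 else (k : ℝ) ^ (-θ)) * u k
      = ∑ k ∈ Finset.Icc 1 N, (k : ℝ) ^ (-θ) * u k :=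
    Finset.sum_congr rfl fun k hk => by
      rw [if_neg (by have := (Finset.mem_Icc.1 hk).1; omega)]
  rw [h2]
  calc _ ≤ B * (N : ℝ) ^ (δ - θ) + K * B * (N : ℝ) ^ (δ - θ) := by
        refine add_le_add (h0.trans ?_) h1
        exact le_mul_of_one_le_right (by positivity) (Real.one_le_rpow hN0 (by linarith))
    _ = _ := by
        rw [hB, Real.rpow_sub (by linarith)]
        field_simp
        ring

end Renewal

/-! ### Contacts and the energy of the renewal set -/

lemma contact_nonneg {Ω : Type*} {τ : ℕ → Ω → ℕ} (n : ℕ) (x : Ω) : 0 ≤ contact τ n x :=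
  Set.indicator_nonneg (fun _ _ => zero_le_one) x

lemma contact_le_one {Ω : Type*} {τ : ℕ → Ω → ℕ} (n : ℕ) (x : Ω) : contact τ n x ≤ 1 :=
  Set.indicator_le_self' (fun _ _ => zero_le_one) x

section Renewal

variable {Ω : Type*} [MeasurableSpace Ω] {P : Measure Ω} {τ : ℕ → Ω → ℕ} {α : ℝ} {L : ℝ → ℝ}

lemma IsRenewalProcess.measurableSet_contact (hτ : IsRenewalProcess P τ α L) (n : ℕ) :
    MeasurableSet {x | ∃ i, τ i x = n} := by
  have : {x | ∃ i, τ i x = n} = ⋃ i, τ i ⁻¹' {n} := by ext x; simp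
  rw [this]
  exact MeasurableSet.iUnion fun i => hτ.measurable i (measurableSet_singleton n)

lemma IsRenewalProcess.measurable_contact (hτ : IsRenewalProcess P τ α L) (n : ℕ) :
    Measurable (contact τ n) :=
  measurable_one.indicator (hτ.measurableSet_contact n)

/-- Union bound over the indices i and i + l of the two contacts, then independence of increments.
As τ is strictly increasing from 0, i ≤ n and l ≤ k, so indices up to N suffice. -/
lemma IsRenewalProcess.measureReal_contact_inter_le [IsProbabilityMeasure P]
    (hτ : IsRenewalProcess P τ α L) {n k N : ℕ} (hn : n ≤ N) (hk : k ≤ N) :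
    P.real ({x | ∃ i, τ i x = n} ∩ {x | ∃ i, τ i x = n + k})
      ≤ ∑ i ∈ Finset.range (N + 1), P.real {x | τ i x = n} *
        ∑ l ∈ Finset.range (N + 1), P.real {x | τ (i + l) x - τ i x = k} := by
  have hsub : {x | ∃ i, τ i x = n} ∩ {x | ∃ i, τ i x = n + k}
      ⊆ ⋃ i ∈ Finset.range (N + 1), ⋃ l ∈ Finset.range (N + 1),
        ({x | τ i x = n} ∩ {x | τ (i + l) x - τ i x = k}) := by
    rintro x ⟨⟨i, hi⟩, ⟨j, hj⟩⟩
    have hij : i ≤ j := (hτ.strictMono x).le_iff_le.1 (by simp only [hi, hj]; omega)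
    have h1 := hτ.le_sub 0 i x
    have h2 := hτ.le_sub i (j - i) x
    rw [zero_add, hτ.zero x] at h1
    rw [Nat.add_sub_cancel' hij] at h2
    simp only [Set.mem_iUnion, Finset.mem_range]
    refine ⟨i, by omega, j - i, by omega, hi, ?_⟩
    rw [Set.mem_ofPred_eq, Nat.add_sub_cancel' hij]
    omega
  calc _ ≤ _ := measureReal_mono hsub (measure_ne_top _ _)
    _ ≤ ∑ i ∈ Finset.range (N + 1), ∑ l ∈ Finset.range (N + 1),
        P.real ({x | τ i x = n} ∩ {x | τ (i + l) x - τ i x = k}) :=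
      (measureReal_biUnion_finset_le _ _).trans
        (Finset.sum_le_sum fun i _ => measureReal_biUnion_finset_le _ _)
    _ = _ := by
      refine Finset.sum_congr rfl fun i _ => ?_
      rw [Finset.mul_sum]
      refine Finset.sum_congr rfl fun l _ => ?_
      have h := (hτ.indepFun_sub i l).measure_inter_preimage_eq_mul {n} {k}
        (measurableSet_singleton n) (measurableSet_singleton k)
      have h' := congrArg ENNReal.toReal h
      rw [ENNReal.toReal_mul] at h'
      exact h'

/-- A double sum of a symmetric array is controlled by its upper triangle. -/
lemma sum_natAbs_mul_le_two_mul {κ : ℕ → ℝ} {p : ℕ → ℕ → ℝ} (hκ : ∀ k, 0 ≤ κ k)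
    (hp : ∀ n m, 0 ≤ p n m) (hsymm : ∀ n m, p n m = p m n) (N : ℕ) :
    ∑ n ∈ Finset.Icc 1 N, ∑ m ∈ Finset.Icc 1 N, κ ((n : ℤ) - m).natAbs * p n m
      ≤ 2 * ∑ n ∈ Finset.Icc 1 N, ∑ k ∈ Finset.range (N + 1), κ k * p n (n + k) := by
  have hpt : ∀ n m : ℕ, κ ((n : ℤ) - m).natAbs * p n m
      ≤ (if n ≤ m then κ (m - n) * p n m else 0) + (if m ≤ n then κ (n - m) * p m n else 0) := by
    intro n m
    have h1 := mul_nonneg (hκ (m - n)) (hp n m)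
    have h2 := mul_nonneg (hκ (n - m)) (hp m n)
    rcases le_total n m with h | h
    · rw [if_pos h, show ((n : ℤ) - m).natAbs = m - n by omega]
      refine le_add_of_nonneg_right ?_
      split_ifs <;> first | exact h2 | exact le_rfl
    · rw [if_pos h, show ((n : ℤ) - m).natAbs = n - m by omega, hsymm n m]
      refine le_add_of_nonneg_left ?_
      split_ifs
      · rw [hsymm m n]; exact h1
      · exact le_rfl
  have htri : ∑ n ∈ Finset.Icc 1 N, ∑ m ∈ Finset.Icc 1 N,
      (if n ≤ m then κ (m - n) * p n m else 0)
      ≤ ∑ n ∈ Finset.Icc 1 N, ∑ k ∈ Finset.range (N + 1), κ k * p n (n + k) := by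
    refine Finset.sum_le_sum fun n hn => ?_
    have hn1 := (Finset.mem_Icc.1 hn).1
    rw [← Finset.sum_filter]
    have hset : (Finset.Icc 1 N).filter (fun m => n ≤ m) = Finset.Ico n (N + 1) := by
      ext m; simp only [Finset.mem_filter, Finset.mem_Icc, Finset.mem_Ico]; omega
    rw [hset, Finset.sum_Ico_eq_sum_range]
    simp only [Nat.add_sub_cancel_left]
    refine Finset.sum_le_sum_of_subset_of_nonneg (fun k hk => ?_)
      fun k _ _ => mul_nonneg (hκ _) (hp _ _)
    rw [Finset.mem_range] at hk ⊢; omega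
  calc _ ≤ ∑ n ∈ Finset.Icc 1 N, ∑ m ∈ Finset.Icc 1 N,
        ((if n ≤ m then κ (m - n) * p n m else 0) + (if m ≤ n then κ (n - m) * p m n else 0)) :=
        Finset.sum_le_sum fun n _ => Finset.sum_le_sum fun m _ => hpt n m
    _ ≤ _ := by
        simp_rw [Finset.sum_add_distrib]
        rw [Finset.sum_comm (f := fun n m => if m ≤ n then κ (n - m) * p m n else 0), two_mul]
        exact add_le_add htri htri

/-- The expected energy of the renewal set with respect to the kernel `|n - m| ^ (-θ)`. -/
lemma IsRenewalScale.exists_energy_le [IsProbabilityMeasure P]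
    (hτ : IsRenewalProcess P τ α L) {s : ℕ → ℝ} {δ θ : ℝ} (hs : IsRenewalScale P τ s δ)
    (hθ : 0 < θ) (hθδ : θ < δ) :
    ∃ C : ℝ, 0 < C ∧ ∀ N : ℕ, 1 ≤ N →
      ∑ n ∈ Finset.Icc 1 N, ∑ m ∈ Finset.Icc 1 N,
        (if (n : ℤ) - m = 0 then 1 else min (|(((n : ℤ) - m : ℤ) : ℝ)| ^ (-θ)) 1) *
          ∫ x, contact τ n x * contact τ m x ∂P
      ≤ C / (s N ^ 2 * (N : ℝ) ^ θ) := by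
  obtain ⟨C, hC0, hC⟩ := hs.exists_sum_measureReal_le hτ
  obtain ⟨D, hD0, hD⟩ := hs.exists_interaction_le hτ hθ hθδ
  refine ⟨2 * (C * D), by positivity, fun N hN => ?_⟩
  have hsN := hs.pos N hN
  have hN0 : (0 : ℝ) < N := by exact_mod_cast hN
  set κ : ℕ → ℝ := fun k => if k = 0 then 1 else (k : ℝ) ^ (-θ) with hκdef
  have hκ : ∀ k, 0 ≤ κ k := fun k => by simp only [hκdef]; split_ifs <;> positivity
  set p : ℕ → ℕ → ℝ := fun n m => P.real ({x | ∃ i, τ i x = n} ∩ {x | ∃ i, τ i x = m}) with hp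
  have hint : ∀ n m, ∫ x, contact τ n x * contact τ m x ∂P = p n m := by
    intro n m
    simp only [hp]
    rw [← integral_indicator_one
      ((hτ.measurableSet_contact n).inter (hτ.measurableSet_contact m)), Set.inter_indicator_one]
    rfl
  calc _ ≤ ∑ n ∈ Finset.Icc 1 N, ∑ m ∈ Finset.Icc 1 N, κ ((n : ℤ) - m).natAbs * p n m := by
        refine Finset.sum_le_sum fun n _ => Finset.sum_le_sum fun m _ => ?_
        rw [hint]
        refine mul_le_mul_of_nonneg_right ?_ measureReal_nonneg
        simp only [hκdef, Int.natAbs_eq_zero]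
        split_ifs with h
        · exact le_rfl
        · refine (min_le_left _ _).trans (le_of_eq ?_)
          rw [Nat.cast_natAbs, Int.cast_abs]
    _ ≤ 2 * ∑ n ∈ Finset.Icc 1 N, ∑ k ∈ Finset.range (N + 1), κ k * p n (n + k) :=
        sum_natAbs_mul_le_two_mul hκ (fun _ _ => measureReal_nonneg)
          (fun n m => congrArg P.real (Set.inter_comm _ _)) N
    _ ≤ 2 * ∑ n ∈ Finset.Icc 1 N, ∑ k ∈ Finset.range (N + 1), κ k *
          ∑ i ∈ Finset.range (N + 1), P.real {x | τ i x = n} *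
            ∑ l ∈ Finset.range (N + 1), P.real {x | τ (i + l) x - τ i x = k} := by
        refine mul_le_mul_of_nonneg_left (Finset.sum_le_sum fun n hn =>
          Finset.sum_le_sum fun k hk => mul_le_mul_of_nonneg_left ?_ (hκ k)) two_pos.le
        exact hτ.measureReal_contact_inter_le (Finset.mem_Icc.1 hn).2
          (Nat.lt_succ_iff.1 (Finset.mem_range.1 hk))
    -- Summing over the position n first leaves, for each index i, P(τ i ≤ N) times an interaction
    -- bounded uniformly in i.
    _ = 2 * ∑ i ∈ Finset.range (N + 1), (∑ n ∈ Finset.Icc 1 N, P.real {x | τ i x = n}) *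
          ∑ k ∈ Finset.range (N + 1), κ k *
            ∑ l ∈ Finset.range (N + 1), P.real {x | τ (i + l) x - τ i x = k} := by
        congr 1
        simp_rw [Finset.sum_mul]
        rw [Finset.sum_comm (s := Finset.range (N + 1)) (t := Finset.Icc 1 N)]
        refine Finset.sum_congr rfl fun n _ => ?_
        simp_rw [Finset.mul_sum (Finset.range (N + 1))
          (fun i => P.real {x | τ i x = n} * _)]
        rw [Finset.sum_comm]
        refine Finset.sum_congr rfl fun i _ => ?_
        rw [Finset.mul_sum]
        exact Finset.sum_congr rfl fun k _ => by ring
    _ ≤ 2 * ∑ i ∈ Finset.range (N + 1), P.real {x | τ i x ≤ N} * (D / (s N * (N : ℝ) ^ θ)) := by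
        refine mul_le_mul_of_nonneg_left (Finset.sum_le_sum fun i _ => mul_le_mul ?_
          (hD i N (N + 1) hN) (Finset.sum_nonneg fun k _ => mul_nonneg (hκ k)
            (Finset.sum_nonneg fun l _ => measureReal_nonneg)) measureReal_nonneg) two_pos.le
        · have h := sum_measureReal_preimage_singleton (μ := P) (f := τ i) (Finset.Icc 1 N)
            (fun k _ => hτ.measurable i (measurableSet_singleton k))
          refine h.le.trans (measureReal_mono (fun x hx => ?_) (measure_ne_top _ _))
          simp only [Set.mem_preimage, Finset.coe_Icc, Set.mem_Icc] at hx
          exact hx.2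
    _ ≤ 2 * (C / s N * (D / (s N * (N : ℝ) ^ θ))) := by
        rw [← Finset.sum_mul]
        gcongr
        have h := hC 0 N (N + 1) hN
        simpa only [zero_add, hτ.zero, Nat.sub_zero] using h
    _ = _ := by field_simp

/-! ### Exponential moments of the number of contacts -/

/-- The contact τ 0 = 0 is not counted, so if τ l > N only the indices 1, …, l - 1 can contribute.
-/
lemma IsRenewalProcess.le_of_le_sum_contact (hτ : IsRenewalProcess P τ α L) {x : Ω} {N l : ℕ}
    (hl : (l : ℝ) ≤ ∑ n ∈ Finset.Icc 1 N, contact τ n x) : τ l x ≤ N := by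
  classical
  by_contra! hlt
  have hcard : ∑ n ∈ Finset.Icc 1 N, contact τ n x
      = (((Finset.Icc 1 N).filter fun n => ∃ i, τ i x = n).card : ℝ) := by
    rw [Finset.card_filter]
    push_cast
    refine Finset.sum_congr rfl fun n _ => ?_
    simp only [contact, Set.indicator_apply, Set.mem_ofPred_eq, Pi.one_apply]
  have hl0 : l ≠ 0 := by
    rintro rfl
    rw [hτ.zero x] at hlt
    omega
  have hsub : (Finset.Icc 1 N).filter (fun n => ∃ i, τ i x = n)
      ⊆ (Finset.Ico 1 l).image fun i => τ i x := by
    intro n hn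
    obtain ⟨hn1, i, hi⟩ := Finset.mem_filter.1 hn
    obtain ⟨hn1, hn2⟩ := Finset.mem_Icc.1 hn1
    refine Finset.mem_image.2 ⟨i, Finset.mem_Ico.2 ⟨?_, ?_⟩, hi⟩
    · by_contra! h0
      have : i = 0 := by omega
      rw [this, hτ.zero x] at hi
      omega
    · exact (hτ.strictMono x).lt_iff_lt.1 (by simp only [hi]; omega)
  have h := (Finset.card_le_card hsub).trans Finset.card_image_le
  rw [Nat.card_Ico] at h
  rw [hcard] at hl
  have hl' : l ≤ ((Finset.Icc 1 N).filter fun n => ∃ i, τ i x = n).card := by exact_mod_cast hl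
  omega

/-- Discrete form of exp(bj) = 1 + ∫₀ʲ b exp(bt) dt; it serves as a layer-cake formula for exp(bK).
-/
lemma exp_mul_natCast_le (b : ℝ) (j : ℕ) :
    Real.exp (b * j) ≤ 1 + b * ∑ l ∈ Finset.Icc 1 j, Real.exp (b * l) := by
  induction j with
  | zero => simp
  | succ j ih =>
    rw [Finset.sum_Icc_succ_top (by omega), mul_add, ← add_assoc]
    have h := Real.add_one_le_exp (-b)
    have h1 : Real.exp (b * j) = Real.exp (b * (j + 1 : ℕ)) * Real.exp (-b) := by
      rw [← Real.exp_add]; push_cast; ring_nf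
    nlinarith [Real.exp_pos (b * (j + 1 : ℕ))]

lemma mul_sum_exp_neg_le_one (b : ℝ) (N : ℕ) :
    b * ∑ l ∈ Finset.Icc 1 N, Real.exp (-(b * l)) ≤ 1 := by
  have h : b * ∑ l ∈ Finset.Icc 1 N, Real.exp (-(b * l)) ≤ 1 - Real.exp (-(b * N)) := by
    induction N with
    | zero => simp
    | succ j ih =>
      rw [Finset.sum_Icc_succ_top (by omega), mul_add]
      have h := Real.add_one_le_exp b
      have h1 : Real.exp (-(b * j)) = Real.exp (-(b * (j + 1 : ℕ))) * Real.exp b := by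
        rw [← Real.exp_add]; push_cast; ring_nf
      nlinarith [Real.exp_pos (-(b * (j + 1 : ℕ)))]
  linarith [Real.exp_pos (-(b * N))]

lemma IsRenewalProcess.exp_sum_contact_le (hτ : IsRenewalProcess P τ α L) {b : ℝ} (hb : 0 ≤ b)
    (N : ℕ) (x : Ω) :
    Real.exp (b * ∑ n ∈ Finset.Icc 1 N, contact τ n x)
      ≤ 1 + b * ∑ l ∈ Finset.Icc 1 N,
        Real.exp (b * l) * Set.indicator {x | τ l x ≤ N} (1 : Ω → ℝ) x := by
  obtain ⟨j, hj⟩ : ∃ j : ℕ, ∑ n ∈ Finset.Icc 1 N, contact τ n x = j := by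
    classical
    refine ⟨((Finset.Icc 1 N).filter fun n => ∃ i, τ i x = n).card, ?_⟩
    rw [Finset.card_filter]
    push_cast
    refine Finset.sum_congr rfl fun n _ => ?_
    simp only [contact, Set.indicator_apply, Set.mem_ofPred_eq, Pi.one_apply]
  have hjN : j ≤ N := by
    have h : (j : ℝ) ≤ N := by
      rw [← hj]
      refine (Finset.sum_le_sum fun n _ => contact_le_one n x).trans ?_
      simp
    exact_mod_cast h
  rw [hj]
  refine (exp_mul_natCast_le b j).trans ?_
  gcongr
  calc _ = ∑ l ∈ Finset.Icc 1 j,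
        Real.exp (b * l) * Set.indicator {x | τ l x ≤ N} (1 : Ω → ℝ) x := by
        refine Finset.sum_congr rfl fun l hl => ?_
        have hlN : τ l x ≤ N := hτ.le_of_le_sum_contact (by
          rw [hj]; exact_mod_cast (Finset.mem_Icc.1 hl).2)
        rw [Set.indicator_of_mem (by exact hlN), Pi.one_apply, mul_one]
    _ ≤ _ := by
        refine Finset.sum_le_sum_of_subset_of_nonneg (Finset.Icc_subset_Icc_right hjN)
          fun l _ _ => mul_nonneg (Real.exp_pos _).le
            (Set.indicator_nonneg (fun _ _ => zero_le_one) x)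

lemma IsRenewalProcess.integrable_exp_sum_contact [IsProbabilityMeasure P]
    (hτ : IsRenewalProcess P τ α L) {b : ℝ} (hb : 0 ≤ b) (N : ℕ) :
    Integrable (fun x => Real.exp (b * ∑ n ∈ Finset.Icc 1 N, contact τ n x)) P := by
  have hm : Measurable (fun x => ∑ n ∈ Finset.Icc 1 N, contact τ n x) :=
    Finset.measurable_fun_sum _ fun n _ => hτ.measurable_contact n
  refine Integrable.of_bound (hm.const_mul b).exp.aestronglyMeasurable (Real.exp (b * N))
    (Eventually.of_forall fun x => ?_)
  rw [Real.norm_of_nonneg (Real.exp_pos _).le]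
  gcongr
  refine (Finset.sum_le_sum fun n _ => contact_le_one n x).trans ?_
  simp

/-- A Laplace gap of 2b makes P(τ l ≤ N) decay like exp(-2bl), which beats the layer-cake weight
exp(bl) and leaves a sum controlled by `mul_sum_exp_neg_le_one`. -/
lemma IsRenewalProcess.integral_exp_sum_contact_le [IsProbabilityMeasure P]
    (hτ : IsRenewalProcess P τ α L) {b : ℝ} (hb : 0 ≤ b) {n : ℕ}
    (hmgf : ∀ i, mgf (fun x => ((τ (i + 1) x - τ i x : ℕ) : ℝ)) P (-(1 / n)) ≤ 1 - 2 * b)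
    (N : ℕ) :
    ∫ x, Real.exp (b * ∑ n ∈ Finset.Icc 1 N, contact τ n x) ∂P ≤ 1 + Real.exp (N / n) := by
  have hr0 : 0 ≤ 1 - 2 * b := mgf_nonneg.trans (hmgf 0)
  have hr : 1 - 2 * b ≤ Real.exp (-(2 * b)) := by linarith [Real.add_one_le_exp (-(2 * b))]
  have hms : ∀ l, MeasurableSet {x | τ l x ≤ N} := fun l => hτ.measurable l measurableSet_Iic
  have hint : ∀ l ∈ Finset.Icc 1 N, Integrable (fun x =>
      Real.exp (b * l) * Set.indicator {x | τ l x ≤ N} (1 : Ω → ℝ) x) P := fun l _ =>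
    ((integrable_const (1 : ℝ)).indicator (hms l)).const_mul _
  have hprob : ∀ l, P.real {x | τ l x ≤ N} ≤ Real.exp (N / n) * (1 - 2 * b) ^ l := fun l => by
    simpa only [zero_add, hτ.zero, Nat.sub_zero] using hτ.measureReal_sub_le hmgf 0 l N
  calc _ ≤ ∫ x, (1 + b * ∑ l ∈ Finset.Icc 1 N,
        Real.exp (b * l) * Set.indicator {x | τ l x ≤ N} (1 : Ω → ℝ) x) ∂P :=
        integral_mono (hτ.integrable_exp_sum_contact hb N)
          ((integrable_const _).add ((integrable_finsetSum _ hint).const_mul _))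
          (hτ.exp_sum_contact_le hb N)
    _ = 1 + b * ∑ l ∈ Finset.Icc 1 N, Real.exp (b * l) * P.real {x | τ l x ≤ N} := by
        rw [integral_add (integrable_const _) ((integrable_finsetSum _ hint).const_mul _),
          integral_const_mul, integral_finsetSum _ hint]
        simp only [integral_const, probReal_univ, smul_eq_mul, mul_one]
        congr 2
        refine Finset.sum_congr rfl fun l _ => ?_
        rw [integral_const_mul, integral_indicator_one (hms l)]
    _ ≤ 1 + b * ∑ l ∈ Finset.Icc 1 N, Real.exp (N / n) * Real.exp (-(b * l)) := by
        refine add_le_add le_rfl (mul_le_mul_of_nonneg_left (Finset.sum_le_sum fun l _ => ?_) hb)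
        calc _ ≤ Real.exp (b * l) * (Real.exp (N / n) * Real.exp (-(2 * b)) ^ l) := by
              gcongr
              exact (hprob l).trans (by gcongr)
          _ = Real.exp (N / n) * Real.exp (-(b * l)) := by
              rw [← Real.exp_nat_mul, ← Real.exp_add, ← Real.exp_add, ← Real.exp_add]
              ring_nf
    _ ≤ _ := by
        rw [← Finset.mul_sum]
        nlinarith [mul_sum_exp_neg_le_one b N, Real.exp_pos ((N : ℝ) / n)]

/-- Exponential moments of the rescaled number of contacts are bounded. -/
lemma IsRenewalScale.exists_integral_exp_le [IsProbabilityMeasure P]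
    (hτ : IsRenewalProcess P τ α L) {s : ℕ → ℝ} {δ : ℝ} (hs : IsRenewalScale P τ s δ)
    (hδ : 0 < δ) {a : ℝ} (ha : 0 ≤ a) :
    ∃ C : ℝ, 0 < C ∧ ∀ N : ℕ, 1 ≤ N →
      ∫ x, Real.exp (a * s N * ∑ n ∈ Finset.Icc 1 N, contact τ n x) ∂P ≤ C := by
  obtain ⟨c, hc0, hc⟩ := hs.mgf_gap_le
  obtain ⟨D, hD0, hD⟩ := hs.almost_anti
  -- With n ≈ N/M, almost monotonicity gives s n ≥ (N/n)^δ s N / D, so a large M makes c s n ≥ 2 a s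
  -- N. The price is a factor exp(N/n) ≤ exp(M). For N ≤ M there are at most M contacts.
  obtain ⟨M, hM1, hM⟩ : ∃ M : ℕ, 1 ≤ M ∧ 2 * a * D / c ≤ ((M : ℝ) / 2) ^ δ := by
    have h : Tendsto (fun M : ℕ => ((M : ℝ) / 2) ^ δ) atTop atTop :=
      (tendsto_rpow_atTop hδ).comp (tendsto_natCast_atTop_atTop.atTop_div_const two_pos)
    obtain ⟨M, h1, h2⟩ := ((eventually_ge_atTop 1).and (h.eventually_ge_atTop (2 * a * D / c))).exists
    exact ⟨M, h1, h2⟩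
  have hM0 : (0 : ℝ) < M := by exact_mod_cast hM1
  refine ⟨(1 + Real.exp M) + Real.exp (a * (D * s 1) * M), by positivity, fun N hN => ?_⟩
  have hN0 : (1 : ℝ) ≤ N := by exact_mod_cast hN
  have hsN := hs.pos N hN
  rcases le_total M N with hMN | hNM
  · set n : ℕ := ⌈(N : ℝ) / M⌉₊ with hn
    have hMN' : (1 : ℝ) ≤ (N : ℝ) / M := (one_le_div hM0).2 (by exact_mod_cast hMN)
    have hnN : n ≤ N := Nat.ceil_le.2 (div_le_self (by positivity) (by exact_mod_cast hM1))
    have hn1 : 1 ≤ n := Nat.one_le_ceil_iff.2 (by positivity)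
    have hn0 : (0 : ℝ) < n := by exact_mod_cast hn1
    have hle : (N : ℝ) / M ≤ n := Nat.le_ceil _
    have hlt : (n : ℝ) < N / M + 1 := Nat.ceil_lt_add_one (by positivity)
    have hratio : (M : ℝ) / 2 ≤ N / n := by
      rw [div_le_div_iff₀ two_pos hn0]
      have h1 : (n : ℝ) ≤ 2 * (N / M) := by linarith
      calc (M : ℝ) * n ≤ M * (2 * (N / M)) := by gcongr
        _ = N * 2 := by field_simp
    have hb : 2 * (a * s N) ≤ c * s n := by
      have h1 := hD n N hn1 hnN
      have h2 : 2 * a * D / c ≤ (N : ℝ) ^ δ / (n : ℝ) ^ δ := by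
        rw [← Real.div_rpow (by positivity) (by positivity)]
        exact hM.trans (Real.rpow_le_rpow (by positivity) hratio hδ.le)
      rw [div_le_div_iff₀ hc0 (by positivity)] at h2
      have hnp : 0 < (n : ℝ) ^ δ := by positivity
      have h3 : (2 * (a * s N)) * (D * (n : ℝ) ^ δ) ≤ (c * s n) * (D * (n : ℝ) ^ δ) := by
        calc _ = s N * (2 * a * D * (n : ℝ) ^ δ) := by ring
          _ ≤ s N * ((N : ℝ) ^ δ * c) := by gcongr
          _ = c * (s N * (N : ℝ) ^ δ) := by ring
          _ ≤ c * (D * (s n * (n : ℝ) ^ δ)) := by gcongr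
          _ = _ := by ring
      exact le_of_mul_le_mul_right h3 (by positivity)
    refine (hτ.integral_exp_sum_contact_le (b := a * s N) (by positivity)
      (fun i => (hc i n hn1).trans (by linarith)) N).trans ?_
    have hNn : (N : ℝ) / n ≤ M := by
      rw [div_le_iff₀ hn0]
      rwa [div_le_iff₀ hM0, mul_comm] at hle
    have := Real.exp_le_exp.2 hNn
    linarith [Real.exp_pos (a * (D * s 1) * M)]
  · have hsle : s N ≤ D * s 1 := by
      have h := hD 1 N le_rfl hN
      rw [Nat.cast_one, Real.one_rpow, mul_one] at h
      exact (le_mul_of_one_le_right hsN.le (Real.one_le_rpow hN0 hδ.le)).trans h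
    calc _ ≤ ∫ _, Real.exp (a * (D * s 1) * M) ∂P := by
          refine integral_mono (hτ.integrable_exp_sum_contact (by positivity) N)
            (integrable_const _) fun x => ?_
          have hK : ∑ n ∈ Finset.Icc 1 N, contact τ n x ≤ M := by
            refine (Finset.sum_le_sum fun n _ => contact_le_one n x).trans ?_
            simpa using hNM
          have hK0 : 0 ≤ ∑ n ∈ Finset.Icc 1 N, contact τ n x :=
            Finset.sum_nonneg fun n _ => contact_nonneg n x
          have hs1 := hs.pos 1 le_rfl
          simp only
          gcongr
      _ = Real.exp (a * (D * s 1) * M) := by simp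
      _ ≤ _ := by linarith [Real.exp_pos (M : ℝ)]

end Renewal

/-! ### Gaussian Wick exponentials -/

section Gaussian

variable {Ω : Type*} [MeasurableSpace Ω] {P : Measure Ω}

lemma mgf_of_hasGaussianLaw {X : Ω → ℝ} (hX : HasGaussianLaw X P) (h0 : ∫ y, X y ∂P = 0)
    (t : ℝ) : mgf X P t = Real.exp (variance X P * t ^ 2 / 2) := by
  rw [mgf_gaussianReal hX.map_eq_gaussianReal, h0, Real.coe_toNNReal _ (variance_nonneg X P),
    zero_mul, zero_add]

lemma lintegral_exp_of_hasGaussianLaw {X : Ω → ℝ} (hX : HasGaussianLaw X P)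
    (h0 : ∫ y, X y ∂P = 0) (t : ℝ) :
    ∫⁻ y, ENNReal.ofReal (Real.exp (t * X y)) ∂P
      = ENNReal.ofReal (Real.exp (variance X P * t ^ 2 / 2)) := by
  have hmgf := mgf_of_hasGaussianLaw hX h0 t
  -- Without integrability `mgf` would take its default value 0, but the formula shows it is
  -- positive.
  have hint : Integrable (fun y => Real.exp (t * X y)) P := by
    by_contra h
    rw [mgf_undef h] at hmgf
    exact (Real.exp_pos _).ne hmgf
  rw [← hmgf, mgf, ofReal_integral_eq_lintegral_ofReal hint
    (Eventually.of_forall fun y => (Real.exp_pos _).le)]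

/-- The Wick exponential of a centred Gaussian variable has mean one. -/
lemma setLIntegral_wickExp_le_one {X : Ω → ℝ} (hX : HasGaussianLaw X P)
    (h0 : ∫ y, X y ∂P = 0) (s : Set Ω) :
    ∫⁻ y in s, ENNReal.ofReal (Real.exp (X y - 1 / 2 * variance X P)) ∂P ≤ 1 := by
  refine (setLIntegral_le_lintegral s _).trans (le_of_eq ?_)
  have h := lintegral_exp_of_hasGaussianLaw hX h0 1
  simp only [one_mul, one_pow, mul_one] at h
  simp_rw [Real.exp_sub, div_eq_mul_inv, ENNReal.ofReal_mul (Real.exp_pos _).le]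
  rw [lintegral_mul_const' _ _ ENNReal.ofReal_ne_top, h,
    ← ENNReal.ofReal_mul (Real.exp_pos _).le, ← Real.exp_neg, ← Real.exp_add]
  ring_nf
  simp

/-- Apply u ≤ t u² + 1/t to the Wick exponential u, whose second moment is exp(2V - V) = exp(V); the
constant 1/t only sees the mass of s. -/
lemma setLIntegral_wickExp_le [IsFiniteMeasure P] {X : Ω → ℝ} (hX : HasGaussianLaw X P)
    (h0 : ∫ y, X y ∂P = 0) (s : Set Ω) {t : ℝ} (ht : 0 < t) :
    ∫⁻ y in s, ENNReal.ofReal (Real.exp (X y - 1 / 2 * variance X P)) ∂P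
      ≤ ENNReal.ofReal (t * Real.exp (variance X P) + P.real s / t) := by
  set V := variance X P with hV
  have hpt : ∀ y, ENNReal.ofReal (Real.exp (X y - 1 / 2 * V))
      ≤ ENNReal.ofReal (t * Real.exp (-V)) * ENNReal.ofReal (Real.exp (2 * X y))
        + ENNReal.ofReal (1 / t) := by
    intro y
    rw [← ENNReal.ofReal_mul (by positivity), ← ENNReal.ofReal_add (by positivity) (by positivity)]
    refine ENNReal.ofReal_le_ofReal ?_
    set u := Real.exp (X y - 1 / 2 * V) with hu
    have hu2 : t * Real.exp (-V) * Real.exp (2 * X y) = t * u ^ 2 := by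
      rw [mul_assoc, ← Real.exp_add, hu, ← Real.exp_nat_mul]
      congr 2
      push_cast; ring
    have hu0 : 0 < u := Real.exp_pos _
    rw [hu2]
    have h1 : t * u ^ 2 + 1 / t - u = t * (u - 1 / t) ^ 2 + u := by field_simp; ring
    have h2 : 0 ≤ t * (u - 1 / t) ^ 2 := by positivity
    linarith
  calc _ ≤ ∫⁻ y in s, (ENNReal.ofReal (t * Real.exp (-V)) * ENNReal.ofReal (Real.exp (2 * X y))
        + ENNReal.ofReal (1 / t)) ∂P := lintegral_mono hpt
    _ = ENNReal.ofReal (t * Real.exp (-V)) * ∫⁻ y in s, ENNReal.ofReal (Real.exp (2 * X y)) ∂P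
        + ENNReal.ofReal (1 / t) * P s := by
        rw [lintegral_add_right _ measurable_const, lintegral_const_mul' _ _ ENNReal.ofReal_ne_top,
          setLIntegral_const]
    _ ≤ ENNReal.ofReal (t * Real.exp (-V)) * ENNReal.ofReal (Real.exp (V * 2 ^ 2 / 2))
        + ENNReal.ofReal (1 / t) * ENNReal.ofReal (P.real s) := by
        gcongr
        · exact (setLIntegral_le_lintegral s _).trans
            (lintegral_exp_of_hasGaussianLaw hX h0 2).le
        · rw [ofReal_measureReal]
    _ = _ := by
        rw [← ENNReal.ofReal_mul (by positivity), ← ENNReal.ofReal_mul (by positivity),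
          ← ENNReal.ofReal_add (by positivity) (by positivity), mul_assoc, ← Real.exp_add]
        ring_nf

variable {ω : ℕ+ → Ω → ℝ} {γ : ℤ → ℝ} {H : ℝ}

lemma IsCorrelatedGaussianEnvironment.hasGaussianLaw_sum
    (hω : IsCorrelatedGaussianEnvironment P ω γ H) (F : Finset ℕ+) (c : ℕ+ → ℝ) :
    HasGaussianLaw (fun y => ∑ n ∈ F, c n * ω n y) P :=
  (hω.gaussian.smul c).hasGaussianLaw_fun_sum

lemma IsCorrelatedGaussianEnvironment.integral_sum
    (hω : IsCorrelatedGaussianEnvironment P ω γ H) (F : Finset ℕ+) (c : ℕ+ → ℝ) :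
    ∫ y, ∑ n ∈ F, c n * ω n y ∂P = 0 := by
  rw [integral_finsetSum _ fun n _ => ((hω.gaussian.hasGaussianLaw_eval n).integrable).const_mul _]
  simp [integral_const_mul, hω.mean_zero]

lemma IsCorrelatedGaussianEnvironment.variance_sum
    (hω : IsCorrelatedGaussianEnvironment P ω γ H) (F : Finset ℕ+) (c : ℕ+ → ℝ) :
    variance (fun y => ∑ n ∈ F, c n * ω n y) P
      = ∑ n ∈ F, ∑ m ∈ F, γ (((n : ℕ) : ℤ) - ((m : ℕ) : ℤ)) * (c n * c m) := by
  have hint : ∀ n m, Integrable (fun y => c n * c m * (ω n y * ω m y)) P := fun n m =>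
    ((hω.gaussian.hasGaussianLaw_eval n).memLp_two.integrable_mul
      (hω.gaussian.hasGaussianLaw_eval m).memLp_two).const_mul _
  rw [variance_of_integral_eq_zero (hω.hasGaussianLaw_sum F c).aemeasurable (hω.integral_sum F c)]
  have hsq : ∀ y, (∑ n ∈ F, c n * ω n y) ^ 2
      = ∑ n ∈ F, ∑ m ∈ F, c n * c m * (ω n y * ω m y) := fun y => by
    rw [sq, Finset.sum_mul_sum]
    exact Finset.sum_congr rfl fun n _ => Finset.sum_congr rfl fun m _ => by ring
  simp_rw [hsq]
  rw [integral_finsetSum _ fun n _ => integrable_finsetSum _ fun m _ => hint n m]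
  refine Finset.sum_congr rfl fun n _ => ?_
  rw [integral_finsetSum _ fun m _ => hint n m]
  refine Finset.sum_congr rfl fun m _ => ?_
  rw [integral_const_mul, hω.covariance, mul_comm]

end Gaussian

/-! ### The partition function: truncation and mean variance -/

lemma sum_pnat_Icc {M : Type*} [AddCommMonoid M] (f : ℕ → M) (N : ℕ+) :
    ∑ n ∈ Finset.Icc 1 N, f n = ∑ n ∈ Finset.Icc 1 (N : ℕ), f n := by
  refine Finset.sum_nbij (fun n => (n : ℕ)) (fun n hn => ?_) (fun a _ b _ h => PNat.coe_injective h)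
    (fun k hk => ?_) fun _ _ => rfl
  · exact Finset.mem_Icc.2 ⟨n.pos, PNat.coe_le_coe _ _ |>.2 (Finset.mem_Icc.1 hn).2⟩
  · obtain ⟨hk1, hk2⟩ := Finset.mem_Icc.1 (Finset.mem_coe.1 hk)
    exact ⟨⟨k, hk1⟩, Finset.mem_coe.2 (Finset.mem_Icc.2 ⟨one_le, hk2⟩), rfl⟩

section Partition

variable {Ωτ Ωω : Type*} [MeasurableSpace Ωω] {Pω : Measure Ωω} {τ : ℕ → Ωτ → ℕ}
  {ω : ℕ+ → Ωω → ℝ} {γ : ℤ → ℝ} {H : ℝ}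

/-- The variance of the energy `∑ β ω_n 1_{n ∈ τ}` for a given renewal trajectory. -/
def contactVariance (γ : ℤ → ℝ) (τ : ℕ → Ωτ → ℕ) (N : ℕ+) (β : ℝ) (x : Ωτ) : ℝ :=
  ∑ n ∈ Finset.Icc 1 (N : ℕ), ∑ m ∈ Finset.Icc 1 (N : ℕ),
    γ ((n : ℤ) - m) * (β * contact τ n x * (β * contact τ m x))

lemma IsCorrelatedGaussianEnvironment.variance_eq_contactVariance
    (hω : IsCorrelatedGaussianEnvironment Pω ω γ H) (N : ℕ+) (β : ℝ) (x : Ωτ) :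
    variance (fun y => ∑ n ∈ Finset.Icc 1 N, β * contact τ n x * ω n y) Pω
      = contactVariance γ τ N β x := by
  rw [hω.variance_sum _ fun n : ℕ+ => β * contact τ n x, contactVariance,
    ← sum_pnat_Icc fun n => ∑ m ∈ Finset.Icc 1 (N : ℕ),
      γ ((n : ℤ) - m) * (β * contact τ n x * (β * contact τ m x))]
  refine Finset.sum_congr rfl fun n _ => ?_
  exact sum_pnat_Icc (fun m => γ (((n : ℕ) : ℤ) - m) * (β * contact τ n x * (β * contact τ m x))) N

/-- The Boltzmann weight factors into a pinning term and a Wick exponential. -/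
lemma IsCorrelatedGaussianEnvironment.wick_weight_eq
    (hω : IsCorrelatedGaussianEnvironment Pω ω γ H) (N : ℕ+) (β h : ℝ) (x : Ωτ) (y : Ωω) :
    Real.exp ((∑ n ∈ Finset.Icc 1 N, (β * ω n y + h) * contact τ n x)
      - (1 / 2) * variance (fun y' => ∑ n ∈ Finset.Icc 1 N, β * ω n y' * contact τ n x) Pω)
    = Real.exp (h * ∑ n ∈ Finset.Icc 1 (N : ℕ), contact τ n x) *
      Real.exp ((∑ n ∈ Finset.Icc 1 N, β * contact τ n x * ω n y)
        - 1 / 2 * contactVariance γ τ N β x) := by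
  have h1 : (fun y' => ∑ n ∈ Finset.Icc 1 N, β * ω n y' * contact τ n x)
      = fun y' => ∑ n ∈ Finset.Icc 1 N, β * contact τ n x * ω n y' := by
    ext y'
    exact Finset.sum_congr rfl fun n _ => by ring
  rw [h1, hω.variance_eq_contactVariance, ← Real.exp_add,
    ← sum_pnat_Icc (fun n => contact τ n x), Finset.mul_sum, ← add_sub_assoc,
    ← Finset.sum_add_distrib]
  congr 2
  exact Finset.sum_congr rfl fun n _ => by ring

end Partition

section Partition

variable {Ωτ Ωω : Type*} [MeasurableSpace Ωτ] [MeasurableSpace Ωω]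
  {Pτ : Measure Ωτ} {Pω : Measure Ωω} {τ : ℕ → Ωτ → ℕ} {ω : ℕ+ → Ωω → ℝ}
  {α H : ℝ} {L : ℝ → ℝ} {γ : ℤ → ℝ}

lemma measurable_contactVariance (hτ : IsRenewalProcess Pτ τ α L) (N : ℕ+) (β : ℝ) :
    Measurable (contactVariance γ τ N β) :=
  Finset.measurable_fun_sum _ fun n _ => Finset.measurable_fun_sum _ fun m _ =>
    (((hτ.measurable_contact n).const_mul β).mul
      ((hτ.measurable_contact m).const_mul β)).const_mul _

/-- The measure ν is general so as to cover both Pω and its restriction to an event. -/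
lemma aemeasurable_wick_weight {ν : Measure Ωω} [SFinite ν] [SFinite Pτ]
    (hτ : IsRenewalProcess Pτ τ α L) (hω : ∀ n, AEMeasurable (ω n) ν) (N : ℕ+) (β h : ℝ) :
    AEMeasurable (fun z : Ωω × Ωτ =>
      Real.exp (h * ∑ n ∈ Finset.Icc 1 (N : ℕ), contact τ n z.2) *
      Real.exp ((∑ n ∈ Finset.Icc 1 N, β * contact τ n z.2 * ω n z.1)
        - 1 / 2 * contactVariance γ τ N β z.2)) (ν.prod Pτ) := by
  have h1 : ∀ n : ℕ, AEMeasurable (fun z : Ωω × Ωτ => contact τ n z.2) (ν.prod Pτ) := fun n =>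
    ((hτ.measurable_contact n).comp measurable_snd).aemeasurable
  have h2 : AEMeasurable (fun z : Ωω × Ωτ => contactVariance γ τ N β z.2) (ν.prod Pτ) :=
    ((measurable_contactVariance hτ N β).comp measurable_snd).aemeasurable
  have h3 : ∀ n, AEMeasurable (fun z : Ωω × Ωτ => ω n z.1) (ν.prod Pτ) := fun n =>
    (hω n).comp_fst
  refine (Real.measurable_exp.comp_aemeasurable
    ((Finset.aemeasurable_fun_sum _ fun n _ => h1 n).const_mul h)).mul
    (Real.measurable_exp.comp_aemeasurable
      (AEMeasurable.sub (Finset.aemeasurable_fun_sum _ fun n _ => ?_) (h2.const_mul _)))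
  exact ((h1 n).const_mul β).mul (h3 n)

lemma wickPartition_eq (hω : IsCorrelatedGaussianEnvironment Pω ω γ H) (N : ℕ+) (β h : ℝ) :
    wickPartition Pτ Pω τ ω N β h = fun y => ∫ x,
      Real.exp (h * ∑ n ∈ Finset.Icc 1 (N : ℕ), contact τ n x) *
      Real.exp ((∑ n ∈ Finset.Icc 1 N, β * contact τ n x * ω n y)
        - 1 / 2 * contactVariance γ τ N β x) ∂Pτ := by
  ext y
  simp_rw [wickPartition, hω.wick_weight_eq]

lemma aestronglyMeasurable_wickPartition [IsProbabilityMeasure Pτ] [IsProbabilityMeasure Pω]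
    (hτ : IsRenewalProcess Pτ τ α L) (hω : IsCorrelatedGaussianEnvironment Pω ω γ H)
    (N : ℕ+) (β h : ℝ) : AEStronglyMeasurable (wickPartition Pτ Pω τ ω N β h) Pω := by
  rw [wickPartition_eq hω]
  exact (aemeasurable_wick_weight hτ
    hω.gaussian.aemeasurable N β h).aestronglyMeasurable.integral_prod_right'

/-- Truncation at variance level `A` inside the expectation over the renewal process. -/
lemma setLIntegral_enorm_wickPartition_le [IsProbabilityMeasure Pτ] [IsProbabilityMeasure Pω]
    (hτ : IsRenewalProcess Pτ τ α L) (hω : IsCorrelatedGaussianEnvironment Pω ω γ H)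
    (N : ℕ+) (β h : ℝ) (s : Set Ωω) {A t η : ℝ} (hA : 0 < A) (ht : 0 < t) (hη : 0 < η) :
    ∫⁻ y in s, ‖wickPartition Pτ Pω τ ω N β h y‖ₑ ∂Pω
      ≤ ∫⁻ x, ENNReal.ofReal ((t * Real.exp A + Pω.real s / t + η) *
          Real.exp (2 * |h| * ∑ n ∈ Finset.Icc 1 (N : ℕ), contact τ n x)
            + contactVariance γ τ N β x / (η * A)) ∂Pτ := by
  rw [wickPartition_eq hω]
  set K : Ωτ → ℝ := fun x => ∑ n ∈ Finset.Icc 1 (N : ℕ), contact τ n x with hK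
  set X : Ωτ → Ωω → ℝ := fun x y => ∑ n ∈ Finset.Icc 1 N, β * contact τ n x * ω n y with hX
  set V : Ωτ → ℝ := contactVariance γ τ N β with hV
  have hVX : ∀ x, variance (X x) Pω = V x := hω.variance_eq_contactVariance N β
  calc _ ≤ ∫⁻ y in s, ∫⁻ x, ENNReal.ofReal
          (Real.exp (h * K x) * Real.exp (X x y - 1 / 2 * V x)) ∂Pτ ∂Pω := by
        refine lintegral_mono fun y => (enorm_integral_le_lintegral_enorm _).trans (le_of_eq ?_)
        refine lintegral_congr fun x => ?_
        exact Real.enorm_of_nonneg (by positivity)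
    _ = ∫⁻ x, ∫⁻ y in s, ENNReal.ofReal
          (Real.exp (h * K x) * Real.exp (X x y - 1 / 2 * V x)) ∂Pω ∂Pτ :=
        lintegral_lintegral_swap (aemeasurable_wick_weight (ν := Pω.restrict s) hτ
          (fun n => (hω.gaussian.aemeasurable n).restrict) N β h).ennreal_ofReal
    _ ≤ _ := by
        refine lintegral_mono fun x => ?_
        simp_rw [ENNReal.ofReal_mul (Real.exp_pos _).le]
        rw [lintegral_const_mul' _ _ ENNReal.ofReal_ne_top]
        have hG : HasGaussianLaw (X x) Pω :=
          hω.hasGaussianLaw_sum (Finset.Icc 1 N) fun n => β * contact τ n x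
        have h0 : ∫ y, X x y ∂Pω = 0 := hω.integral_sum _ fun n => β * contact τ n x
        have hK0 : 0 ≤ K x := Finset.sum_nonneg fun n _ => contact_nonneg n x
        have hV0 : 0 ≤ V x := hVX x ▸ variance_nonneg _ _
        have hs0 : 0 ≤ Pω.real s := measureReal_nonneg
        have hE : Real.exp (h * K x) ≤ Real.exp (2 * |h| * K x) := by
          gcongr
          linarith [le_abs_self h, abs_nonneg h]
        -- Low variance uses the L² bound. High variance uses only mean 1, then u ≤ η u² + 1/η and 1
        -- ≤ V/A.
        rcases le_or_gt (V x) A with hVA | hVA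
        · have h1 := setLIntegral_wickExp_le hG h0 s ht
          rw [hVX] at h1
          calc _ ≤ ENNReal.ofReal (Real.exp (h * K x)) *
                ENNReal.ofReal (t * Real.exp (V x) + Pω.real s / t) := by gcongr
            _ ≤ _ := by
              rw [← ENNReal.ofReal_mul (Real.exp_pos _).le]
              refine ENNReal.ofReal_le_ofReal ?_
              calc _ ≤ Real.exp (2 * |h| * K x) * (t * Real.exp A + Pω.real s / t) := by gcongr
                _ = (t * Real.exp A + Pω.real s / t + 0) * Real.exp (2 * |h| * K x) + 0 := by ring
                _ ≤ _ := by gcongr; positivity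
        · have h1 := setLIntegral_wickExp_le_one hG h0 s
          rw [hVX] at h1
          calc _ ≤ ENNReal.ofReal (Real.exp (h * K x)) * 1 := by gcongr
            _ ≤ _ := by
              rw [mul_one]
              refine ENNReal.ofReal_le_ofReal ?_
              set u := Real.exp (h * K x) with hu
              have hu0 : 0 < u := Real.exp_pos _
              have h2 : u ≤ η * u ^ 2 + 1 / η := by
                have h1 : η * u ^ 2 + 1 / η - u = η * (u - 1 / η) ^ 2 + u := by field_simp; ring
                have h2 : 0 ≤ η * (u - 1 / η) ^ 2 := by positivity
                linarith
              have h3 : u ^ 2 ≤ Real.exp (2 * |h| * K x) := by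
                rw [hu, ← Real.exp_nat_mul]
                refine Real.exp_le_exp.2 ?_
                push_cast
                rw [← mul_assoc]
                gcongr
                exact le_abs_self h
              have h4 : 1 / η ≤ V x / (η * A) := by
                rw [div_le_div_iff₀ hη (by positivity)]
                nlinarith
              calc u ≤ η * Real.exp (2 * |h| * K x) + V x / (η * A) := by
                    refine h2.trans (add_le_add ?_ h4)
                    gcongr
                _ = (0 + η) * Real.exp (2 * |h| * K x) + V x / (η * A) := by rw [zero_add]
                _ ≤ _ := by gcongr; positivity

/-- The expected variance of the rescaled energy is bounded. -/
lemma exists_integral_contactVariance_le [IsProbabilityMeasure Pτ]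
    (hτ : IsRenewalProcess Pτ τ α L) {s : ℕ → ℝ} {δ : ℝ} (hs : IsRenewalScale Pτ τ s δ)
    (hω : IsCorrelatedGaussianEnvironment Pω ω γ H) (hH : H < 1) (hδ : 2 - 2 * H < δ)
    (βhat : ℝ) :
    ∃ E : ℝ, 0 < E ∧ ∀ N : ℕ+,
      ∫ x, contactVariance γ τ N (βhat * (s N * ((N : ℕ) : ℝ) ^ (1 - H))) x ∂Pτ ≤ E := by
  obtain ⟨C, hC0, hC⟩ := hω.upper_bound
  obtain ⟨D, hD0, hD⟩ := hs.exists_energy_le hτ (θ := 2 - 2 * H) (by linarith) hδ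
  -- The summand 1 keeps the bound positive even when βhat = 0.
  refine ⟨C * βhat ^ 2 * D + 1, by positivity, fun N => ?_⟩
  have hN0 : (0 : ℝ) < ((N : ℕ) : ℝ) := by exact_mod_cast N.pos
  have hsN := hs.pos N N.pos
  set β : ℝ := βhat * (s N * ((N : ℕ) : ℝ) ^ (1 - H)) with hβ
  have hcint : ∀ n m, Integrable (fun x => contact τ n x * contact τ m x) Pτ := fun n m => by
    refine Integrable.of_bound
      ((hτ.measurable_contact n).mul (hτ.measurable_contact m)).aestronglyMeasurable 1
      (Eventually.of_forall fun x => ?_)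
    rw [Real.norm_of_nonneg (mul_nonneg (contact_nonneg n x) (contact_nonneg m x))]
    exact mul_le_one₀ (contact_le_one n x) (contact_nonneg m x) (contact_le_one m x)
  have heq : ∀ x, contactVariance γ τ N β x = ∑ n ∈ Finset.Icc 1 (N : ℕ),
      ∑ m ∈ Finset.Icc 1 (N : ℕ), γ ((n : ℤ) - m) * β ^ 2 * (contact τ n x * contact τ m x) :=
    fun x => Finset.sum_congr rfl fun n _ => Finset.sum_congr rfl fun m _ => by ring
  simp_rw [heq]
  rw [integral_finsetSum _ fun n _ => integrable_finsetSum _ fun m _ => (hcint n m).const_mul _]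
  calc _ ≤ ∑ n ∈ Finset.Icc 1 (N : ℕ), ∑ m ∈ Finset.Icc 1 (N : ℕ), C * β ^ 2 *
        ((if (n : ℤ) - m = 0 then 1 else min (|(((n : ℤ) - m : ℤ) : ℝ)| ^ (-(2 - 2 * H))) 1) *
          ∫ x, contact τ n x * contact τ m x ∂Pτ) := by
        refine Finset.sum_le_sum fun n _ => ?_
        rw [integral_finsetSum _ fun m _ => (hcint n m).const_mul _]
        refine Finset.sum_le_sum fun m _ => ?_
        rw [integral_const_mul, show -(2 - 2 * H) = 2 * H - 2 by ring]
        -- An upper bound on γ is enough, since it multiplies nonnegative joint contact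
        -- probabilities.
        have h := hC ((n : ℤ) - m)
        have hI : 0 ≤ ∫ x, contact τ n x * contact τ m x ∂Pτ :=
          integral_nonneg fun x => mul_nonneg (contact_nonneg n x) (contact_nonneg m x)
        calc _ ≤ C * _ * β ^ 2 * ∫ x, contact τ n x * contact τ m x ∂Pτ := by gcongr
          _ = _ := by ring
    _ = C * β ^ 2 * ∑ n ∈ Finset.Icc 1 (N : ℕ), ∑ m ∈ Finset.Icc 1 (N : ℕ),
        ((if (n : ℤ) - m = 0 then 1 else min (|(((n : ℤ) - m : ℤ) : ℝ)| ^ (-(2 - 2 * H))) 1) *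
          ∫ x, contact τ n x * contact τ m x ∂Pτ) := by
        simp_rw [Finset.mul_sum]
    _ ≤ C * β ^ 2 * (D / (s N ^ 2 * ((N : ℕ) : ℝ) ^ (2 - 2 * H))) := by
        gcongr
        exact hD N N.pos
    _ = C * βhat ^ 2 * D := by
        have h : ((N : ℕ) : ℝ) ^ (2 - 2 * H) = (((N : ℕ) : ℝ) ^ (1 - H)) ^ 2 := by
          rw [← Real.rpow_natCast, ← Real.rpow_mul hN0.le]
          congr 1
          push_cast; ring
        rw [h, hβ]
        field_simp
    _ ≤ _ := by linarith

lemma integrable_contactVariance [IsProbabilityMeasure Pτ] (hτ : IsRenewalProcess Pτ τ α L)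
    (N : ℕ+) (β : ℝ) : Integrable (contactVariance γ τ N β) Pτ := by
  have hcint : ∀ n m, Integrable (fun x => β * contact τ n x * (β * contact τ m x)) Pτ :=
    fun n m => by
    refine Integrable.of_bound (((hτ.measurable_contact n).const_mul β).mul
      ((hτ.measurable_contact m).const_mul β)).aestronglyMeasurable (|β| * |β|)
      (Eventually.of_forall fun x => ?_)
    rw [Real.norm_eq_abs, abs_mul, abs_mul, abs_mul, abs_of_nonneg (contact_nonneg n x),
      abs_of_nonneg (contact_nonneg m x)]
    have := contact_nonneg (τ := τ) m x
    gcongr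
    · exact mul_le_of_le_one_right (abs_nonneg β) (contact_le_one n x)
    · exact mul_le_of_le_one_right (abs_nonneg β) (contact_le_one m x)
  exact integrable_finsetSum _ fun n _ => integrable_finsetSum _ fun m _ =>
    (hcint n m).const_mul _

end Partition

end CorrelatedPinning

end

/-! ### Conclusion -/

theorem proposition3p3
    {Ωτ Ωω : Type*} [MeasurableSpace Ωτ] [MeasurableSpace Ωω]
    (Pτ : Measure Ωτ) [IsProbabilityMeasure Pτ] (Pω : Measure Ωω) [IsProbabilityMeasure Pω]
    (α H : ℝ) (L : ℝ → ℝ) (γ : ℤ → ℝ) (βhat hhat : ℝ)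
    (τ : ℕ → Ωτ → ℕ) (ω : ℕ+ → Ωω → ℝ)
    (hα : 0 < α) (hL : CorrelatedPinning.IsSlowlyVarying L)
    (hτ : CorrelatedPinning.IsRenewalProcess Pτ τ α L)
    (hω : CorrelatedPinning.IsCorrelatedGaussianEnvironment Pω ω γ H)
    (hβhat : 0 < βhat)
    (hH : H ∈ Set.Ioo (1 / 2 : ℝ) 1) (hαH : 2 < α + 2 * H) :
    UniformIntegrable
      (fun N : ℕ+ => CorrelatedPinning.rescaledWickPartition Pτ Pω τ ω α H L βhat hhat N)
      1 Pω := by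
  open CorrelatedPinning in
  obtain ⟨s, δ, hδ, hs, hscale⟩ := hτ.exists_isRenewalScale hα hL hH hαH βhat hhat
  obtain ⟨M, hM0, hM⟩ := hs.exists_integral_exp_le hτ (by linarith [hH.2])
    (a := 2 * |hhat|) (by positivity)
  obtain ⟨E, hE0, hE⟩ := exists_integral_contactVariance_le hτ hs hω hH.2 hδ βhat
  have hbound : ∀ (N : ℕ+) (S : Set Ωω) (A t η : ℝ), 0 < A → 0 < t → 0 < η →
      ∫⁻ y in S, ‖rescaledWickPartition Pτ Pω τ ω α H L βhat hhat N y‖ₑ ∂Pω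
        ≤ ENNReal.ofReal ((t * Real.exp A + Pω.real S / t + η) * M + E / (η * A)) := by
    intro N S A t η hA ht hη
    rw [rescaledWickPartition, (hscale N).1, (hscale N).2]
    refine (setLIntegral_enorm_wickPartition_le hτ hω N _ _ S hA ht hη).trans ?_
    set β := βhat * (s N * ((N : ℕ) : ℝ) ^ (1 - H))
    have hsN := hs.pos N N.pos
    have habs : 2 * |hhat * s N| = 2 * |hhat| * s N := by
      rw [abs_mul, abs_of_pos hsN, mul_assoc]
    have hV0 : ∀ x, 0 ≤ contactVariance γ τ N β x := fun x =>
      hω.variance_eq_contactVariance N β x ▸ variance_nonneg _ _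
    have hi1 := (hτ.integrable_exp_sum_contact (b := 2 * |hhat| * s N) (by positivity) N).const_mul
      (t * Real.exp A + Pω.real S / t + η)
    have hi2 := (integrable_contactVariance (γ := γ) hτ N β).div_const (η * A)
    have hi3 : Integrable (fun x => (t * Real.exp A + Pω.real S / t + η) *
        Real.exp (2 * |hhat| * s N * ∑ n ∈ Finset.Icc 1 (N : ℕ), contact τ n x)
          + contactVariance γ τ N β x / (η * A)) Pτ := hi1.add hi2
    have hS0 : 0 ≤ Pω.real S := measureReal_nonneg
    rw [habs, ← ofReal_integral_eq_lintegral_ofReal hi3 (Eventually.of_forall fun x =>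
      add_nonneg (by positivity) (div_nonneg (hV0 x) (by positivity)))]
    refine ENNReal.ofReal_le_ofReal ?_
    rw [integral_add hi1 hi2, integral_const_mul, integral_div]
    gcongr
    · exact hM N N.pos
    · exact hE N
  refine ⟨fun N => aestronglyMeasurable_wickPartition hτ hω N _ _, fun ε hε => ?_, ?_⟩
  -- The parameters are fixed in the order η, A, t, and then the size of the event, so that each of
  -- the four error terms is at most ε/4.
  · set η : ℝ := ε / (4 * M) with hη
    have hη0 : 0 < η := by positivity
    set A : ℝ := 4 * E / (η * ε) with hA
    have hA0 : 0 < A := by positivity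
    set t : ℝ := ε / (4 * M * Real.exp A) with ht
    have ht0 : 0 < t := by positivity
    refine ⟨t * ε / (4 * M), by positivity, fun N S hS hSδ => ?_⟩
    rw [eLpNorm_indicator_eq_eLpNorm_restrict hS, eLpNorm_one_eq_lintegral_enorm]
    refine (hbound N S A t η hA0 ht0 hη0).trans (ENNReal.ofReal_le_ofReal ?_)
    have hSr : Pω.real S ≤ t * ε / (4 * M) := ENNReal.toReal_le_of_le_ofReal (by positivity) hSδ
    have h1 : t * Real.exp A * M = ε / 4 := by rw [ht]; field_simp
    have h2 : Pω.real S / t * M ≤ ε / 4 := by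
      calc _ ≤ t * ε / (4 * M) / t * M := by gcongr
        _ = ε / 4 := by field_simp
    have h3 : η * M = ε / 4 := by rw [hη]; field_simp
    have h4 : E / (η * A) = ε / 4 := by rw [hA]; field_simp
    nlinarith
  -- `UniformIntegrable` also asks for a uniform L¹ bound: take the whole space and A = t = η = 1.
  · refine ⟨Real.toNNReal ((1 * Real.exp 1 + Pω.real Set.univ / 1 + 1) * M + E / (1 * 1)),
      fun N => ?_⟩
    rw [eLpNorm_one_eq_lintegral_enorm, ← setLIntegral_univ]
    exact hbound N Set.univ 1 1 1 one_pos one_pos one_pos
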